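/- **Setting.** Let $\mathcal S,\mathcal A$ be finite, $\mathsf P(\cdot|s,a)$ a transition kernel on $\mathcal S$, $\rho$ an initial distribution, $\gamma\in(0,1)$, $r_0,\dots,r_m:\mathcal S\times\mathcal A\to(0,\infty)$ rewards and $c\in\mathbb R^m$. For a stationary policy $\pi\in\Pi$ let $\nu_\rho^\pi(s,a)=(1-\gamma)\sum_{t\ge0}\gamma^t\Pr(s_t=s,a_t=a)$ and $\chi_\rho^\pi(s)=\sum_a\nu_\rho^\pi(s,a)$, where $s_0\sim\rho$, $a_t\sim\pi(\cdot|s_t)$, $s_{t+1}\sim\mathsf P(\cdot|s_t,a_t)$; let $V_i^\pi(\rho)=\mathbb E[\sum_t\gamma^tr_i(s_t,a_t)]$, $V^\pi=(V_1^\pi(\rho),\dots,V_m^\pi(\rho))$ and $\mathcal H(\pi)=-\mathbb E[\sum_t\gamma^t\log\pi(a_t|s_t)]$. Let $V_0^*(\rho)=\max\{V_0^\pi(\rho):\pi\in\Pi,\ V_i^\pi(\rho)\ge c_i,\ i=1,\dots,m\}$, $r_{i,\max}=\max_{s,a}r_i(s,a)$, $R_{\max}=(\sum_{i=1}^mr_{i,\max}^2)^{1/2}$.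 For $\tau,\mu>0$ put $\mathcal L(\pi,\lambda)=V_0^\pi(\rho)+\langle\lambda,V^\pi-c\rangle$, $\mathcal L_{\tau,\mu}(\pi,\lambda)=\mathcal L(\pi,\lambda)+\tau\mathcal H(\pi)+\frac\mu2\|\lambda\|_2^2$, $d_{\tau,\mu}(\lambda)=\max_{\pi\in\Pi}\mathcal L_{\tau,\mu}(\pi,\lambda)$, and let $\lambda^*_{\tau,\mu}$ be the minimizer of $d_{\tau,\mu}$ over $\mathbb R^m_+$. **Assumptions.** (Slater) There are $\xi>0$ and $\pi_\xi\in\Pi$ with $V_i^{\pi_\xi}(\rho)\ge c_i+\xi$ for all $i=1,\dots,m$. Put $B=\frac{r_{0,\max}}{(1-\gamma)\xi}$ and $\Lambda=[0,2B]^m$. (Uniform ergodicity) There are $C_M>0$ and $\beta\in(0,1)$ such that for every $\lambda\in\Lambda$ the chain induced by a maximizer $\pi^*_{\tau,\lambda}$ of $\mathcal L_{\tau,\mu}(\cdot,\lambda)$ has a stationary distribution $\chi$ with $\sup_sd_{TV}(\mathbb P(s_t\in\cdot|s_0=s),\chi)\le C_M\beta^t$ for all $t\ge0$. If $|\mathcal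 S|=1$, assume also $C_M\ge\frac12$ (if $|\mathcal S|\ge2$ this is automatic). **Algorithm (AR-CPO).** Let $L_\nu=\lceil\log_\beta(C_M^{-1})\rceil+(1-\beta)^{-1}+1$, $L_d=\frac{2R_{\max}^2L_\nu}{(1-\gamma)^2\tau}+\mu$, $\alpha=\sqrt{\frac{\mu}{2L_d}}$, $q=\frac{2\alpha-\mu/L_d}{2-\mu/L_d}$, $\eta=\frac{\alpha}{\mu(1-\alpha)}$. Start from $\lambda_0=\bar\lambda_0=0$. For $t=1,\dots,T$ (with $T\ge1$) put $\underline\lambda_t=(1-q)\bar\lambda_{t-1}+q\lambda_{t-1}$; let $\pi_t\in\Pi$ be the policy returned by the inner solver at $\underline\lambda_t$; put $\widehat\nabla d_{\tau,\mu}(\underline\lambda_t)=V^{\pi_t}-c+\mu\underline\lambda_t$, $\lambda_t=\arg\min_{\lambda\in\Lambda}\{\eta[\langle\widehat\nabla d_{\tau,\mu}(\underline\lambda_t),\lambda\rangle+\frac\mu2\|\lambda-\underline\lambda_t\|_2^2]+\frac12\|\lambda-\lambda_{t-1}\|_2^2\}$ and $\bar\lambda_t=(1-\alpha)\bar\lambda_{t-1}+\alpha\lambda_t$.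 The output is a policy $\tilde\pi$ with $$\tilde\pi(a|s)=\frac{(1-\alpha)^{T-1}\nu_\rho^{\pi_1}(s,a)+\sum_{t=2}^T\alpha(1-\alpha)^{T-t}\nu_\rho^{\pi_t}(s,a)}{(1-\alpha)^{T-1}\chi_\rho^{\pi_1}(s)+\sum_{t=2}^T\alpha(1-\alpha)^{T-t}\chi_\rho^{\pi_t}(s)}$$ for all $a$ and all $s$ at which the denominator is not zero (at other $s$, any distribution). **Theorem.** Let $\Delta_t=\mathcal L(\pi^*_{\tau,\underline\lambda_t},\underline\lambda_t)-\mathcal L(\pi_t,\underline\lambda_t)$, $\delta_t=\widehat\nabla d_{\tau,\mu}(\underline\lambda_t)-\nabla d_{\tau,\mu}(\underline\lambda_t)$, $K_0(\lambda)=d_{\tau,\mu}(\bar\lambda_0)-d_{\tau,\mu}(\lambda)+\frac\alpha2(\mu+\frac1\eta)\|\lambda_0-\lambda\|_2^2$ and $$\zeta_T=2\Big(1-\sqrt{\tfrac{\mu}{2L_d}}\Big)^{T/2}\sqrt{\eta K_0(\lambda^*_{\tau,\mu})}+\sqrt{8\eta\sqrt mB\max_{1\le t\le T}\|\delta_t\|_2}.$$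 Then $$V_0^*(\rho)-V_0^{\tilde\pi}(\rho)\le\zeta_T\Big(\tfrac{2R_{\max}}{1-\gamma}+\tfrac{2\sqrt mB}{\eta}\Big)+\sqrt{\tfrac{2L_d}{\mu}}\max_{1\le t\le T}|\Delta_t|+\tfrac{\tau\log|\mathcal A|}{1-\gamma}+6\mu mB^2,$$ $$\|(c-V^{\tilde\pi})_+\|_1\le\zeta_T\Big(\tfrac{2R_{\max}}{(1-\gamma)B}+\tfrac{2\sqrt m}{\eta}\Big)+\sqrt{\tfrac{2L_d}{\mu}}\,\tfrac{\max_{1\le t\le T}|\Delta_t|}{B}+\tfrac{\tau\log|\mathcal A|}{(1-\gamma)B}+6\mu mB+2\Big(1-\sqrt{\tfrac{\mu}{2L_d}}\Big)^{T-1}\tfrac{\sqrt mR_{\max}}{1-\gamma}.$$ -/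

import Mathlib

open scoped BigOperators

noncomputable section

/-- A finite discounted constrained Markov decision process with `m` constraints: transition
kernel `P s a s'`, initial distribution `rho`, positive rewards `r 0` (objective) and
`r 1, …, r m` (constraints), thresholds `c` and discount factor `gam`. -/
structure CMDP (S A : Type*) [Fintype S] [Fintype A] (m : ℕ) where
  P : S → A → S → ℝ
  P_mem : ∀ s a, P s a ∈ stdSimplex ℝ S
  rho : S → ℝ
  rho_mem : rho ∈ stdSimplex ℝ S
  r : Fin (m + 1) → S → A → ℝ
  r_pos : ∀ i s a, 0 < r i s a
  c : EuclideanSpace ℝ (Fin m)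
  gam : ℝ
  gam_pos : 0 < gam
  gam_lt_one : gam < 1

/-- Stationary policies: `π s a` is the probability of action `a` in state `s`. -/
abbrev Policy (S A : Type*) [Fintype A] := {π : S → A → ℝ // ∀ s, π s ∈ stdSimplex ℝ A}

namespace CMDP

variable {S A : Type*} [Fintype S] [Fintype A] {m : ℕ}

/-- The law of `s_t` when `s_0 ∼ p`, `a_k ∼ π(· | s_k)` and `s_{k+1} ∼ P(· | s_k, a_k)`. -/
def stateDist (M : CMDP S A m) (π : Policy S A) (p : S → ℝ) : ℕ → S → ℝ
  | 0 => p
  | t + 1 => fun s' => ∑ s, ∑ a, stateDist M π p t s * π.1 s a * M.P s a s'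

/-- The expected discounted sum `E[∑ₜ γᵗ f(s_t, a_t)]` with `s_0 ∼ ρ`, under the policy `π`. -/
def discounted (M : CMDP S A m) (π : Policy S A) (f : S → A → ℝ) : ℝ :=
  ∑' t : ℕ, M.gam ^ t * ∑ s, ∑ a, M.stateDist π M.rho t s * π.1 s a * f s a

/-- The expected reward `V_i^π(ρ)`, for `i = 0, …, m`. -/
def V (M : CMDP S A m) (i : Fin (m + 1)) (π : Policy S A) : ℝ :=
  M.discounted π (M.r i)

/-- The vector `V^π(ρ) = (V_1^π(ρ), …, V_m^π(ρ))`. -/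
def Vvec (M : CMDP S A m) (π : Policy S A) : EuclideanSpace ℝ (Fin m) :=
  WithLp.toLp 2 fun i => M.V i.succ π

/-- The discounted entropy of a policy (`0 log 0 = 0`). -/
def entropy (M : CMDP S A m) (π : Policy S A) : ℝ :=
  M.discounted π fun s a => -Real.log (π.1 s a)

/-- The discounted state-action visitation distribution `ν_ρ^π(s, a)`. -/
def visit (M : CMDP S A m) (π : Policy S A) (s : S) (a : A) : ℝ :=
  (1 - M.gam) * ∑' t : ℕ, M.gam ^ t * (M.stateDist π M.rho t s * π.1 s a)

/-- The discounted state visitation distribution `χ_ρ^π(s)`. -/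
def stateVisit (M : CMDP S A m) (π : Policy S A) (s : S) : ℝ :=
  ∑ a, M.visit π s a

/-- The optimal value `V_0^*(ρ)` of the constrained problem. -/
def optValue (M : CMDP S A m) : ℝ :=
  sSup {v | ∃ π : Policy S A, (∀ i, M.c i ≤ M.V i.succ π) ∧ v = M.V 0 π}

/-- The maximal reward `r_{i,max}`. -/
def rmax (M : CMDP S A m) (i : Fin (m + 1)) : ℝ :=
  ⨆ x : S × A, M.r i x.1 x.2

/-- `R_max`, the Euclidean norm of `(r_{1,max}, …, r_{m,max})`. -/
def Rmax (M : CMDP S A m) : ℝ :=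
  √(∑ i : Fin m, M.rmax i.succ ^ 2)

/-- The Lagrangian `L(π, lam) = V_0^π(ρ) + ⟨lam, V^π(ρ) - c⟩`. -/
def lagr (M : CMDP S A m) (π : Policy S A) (lam : EuclideanSpace ℝ (Fin m)) : ℝ :=
  M.V 0 π + inner ℝ lam (M.Vvec π - M.c)

/-- The regularized Lagrangian `L(π, lam) + τ H(π) + (μ/2) ‖lam‖²`. -/
def regLagr (M : CMDP S A m) (τ μ : ℝ) (π : Policy S A)
    (lam : EuclideanSpace ℝ (Fin m)) : ℝ :=
  M.lagr π lam + τ * M.entropy π + μ / 2 * ‖lam‖ ^ 2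

/-- The regularized dual function. -/
def dual (M : CMDP S A m) (τ μ : ℝ) (lam : EuclideanSpace ℝ (Fin m)) : ℝ :=
  ⨆ π : Policy S A, M.regLagr τ μ π lam

/-- `π` is a solution of `max_π L_{τ,μ}(π, lam)`. -/
def IsRegOptimal (M : CMDP S A m) (τ μ : ℝ) (lam : EuclideanSpace ℝ (Fin m))
    (π : Policy S A) : Prop :=
  ∀ π' : Policy S A, M.regLagr τ μ π' lam ≤ M.regLagr τ μ π lam

/-- The Slater condition with constant `ξ`. -/
def Slater (M : CMDP S A m) (ξ : ℝ) : Prop :=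
  0 < ξ ∧ ∃ π : Policy S A, ∀ i : Fin m, M.c i + ξ ≤ M.V i.succ π

/-- Total variation distance of two distributions on a finite set. -/
def dTV (p p' : S → ℝ) : ℝ := (1 / 2) * ∑ s, |p s - p' s|

/-- `χ` is a stationary distribution of the chain induced by `π`. -/
def IsStationary (M : CMDP S A m) (π : Policy S A) (χ : S → ℝ) : Prop :=
  χ ∈ stdSimplex ℝ S ∧ ∀ s', ∑ s, ∑ a, χ s * π.1 s a * M.P s a s' = χ s'

/-- Uniform ergodicity, with constants `C` and `β`, of the chain induced by `π`. -/
def UniformlyErgodic [DecidableEq S] (M : CMDP S A m) (π : Policy S A) (C β : ℝ) : Prop :=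
  ∃ χ : S → ℝ, M.IsStationary π χ ∧
    ∀ (t : ℕ) (s : S), dTV (M.stateDist π (Pi.single s 1) t) χ ≤ C * β ^ t

/-- The box `{lam ∈ ℝ₊^m : lam_i ≤ 2B}`. -/
def box (m : ℕ) (B : ℝ) : Set (EuclideanSpace ℝ (Fin m)) :=
  {lam | ∀ i, 0 ≤ lam i ∧ lam i ≤ 2 * B}

/-- The nonnegative orthant `ℝ₊^m`. -/
def orthant (m : ℕ) : Set (EuclideanSpace ℝ (Fin m)) :=
  {lam | ∀ i, 0 ≤ lam i}

/-- The estimate `V^π(ρ) - c + μ lam` of the dual gradient at `lam`. -/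
def gradEst (M : CMDP S A m) (μ : ℝ) (π : Policy S A) (lam : EuclideanSpace ℝ (Fin m)) :
    EuclideanSpace ℝ (Fin m) :=
  M.Vvec π - M.c + μ • lam

/-- `T` iterations of the accelerated dual descent. The policies `π 1, …, π T` returned by the
inner solver are arbitrary; `lamU`, `lam`, `lamB` are the search points, the iterates and their
running averages. -/
structure IsRun (M : CMDP S A m) (T : ℕ) (α q η μ B : ℝ) (π : ℕ → Policy S A)
    (lamU lam lamB : ℕ → EuclideanSpace ℝ (Fin m)) : Prop where
  init : lam 0 = 0
  initB : lamB 0 = 0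
  search : ∀ t < T, lamU (t + 1) = (1 - q) • lamB t + q • lam t
  step_mem : ∀ t < T, lam (t + 1) ∈ box m B
  step : ∀ t < T, IsMinOn
    (fun x => η * (inner ℝ (M.gradEst μ (π (t + 1)) (lamU (t + 1))) x
        + μ / 2 * ‖x - lamU (t + 1)‖ ^ 2) + 1 / 2 * ‖x - lam t‖ ^ 2)
    (box m B) (lam (t + 1))
  average : ∀ t < T, lamB (t + 1) = (1 - α) • lamB t + α • lam (t + 1)

/-- The weighted average of the visitation distributions of `π 1, …, π T`. -/
def mixVisit (M : CMDP S A m) (T : ℕ) (α : ℝ) (π : ℕ → Policy S A) (s : S) (a : A) : ℝ :=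
  (1 - α) ^ (T - 1) * M.visit (π 1) s a
    + ∑ t ∈ Finset.Icc 2 T, α * (1 - α) ^ (T - t) * M.visit (π t) s a

/-- The weighted average of the state visitation distributions of `π 1, …, π T`. -/
def mixStateVisit (M : CMDP S A m) (T : ℕ) (α : ℝ) (π : ℕ → Policy S A) (s : S) : ℝ :=
  (1 - α) ^ (T - 1) * M.stateVisit (π 1) s
    + ∑ t ∈ Finset.Icc 2 T, α * (1 - α) ^ (T - t) * M.stateVisit (π t) s

/-- `πt` is the output policy. In states that are never visited, where the defining quotient
is `0 / 0`, it may be any distribution. -/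
def IsOutput (M : CMDP S A m) (T : ℕ) (α : ℝ) (π : ℕ → Policy S A) (πt : Policy S A) : Prop :=
  ∀ s, M.mixStateVisit T α π s ≠ 0 →
    ∀ a, πt.1 s a = M.mixVisit T α π s a / M.mixStateVisit T α π s

/-- The Lagrangian error of the policy `π`, where `πs` is the regularized optimum at `lam`. -/
def valueErr (M : CMDP S A m) (πs π : Policy S A) (lam : EuclideanSpace ℝ (Fin m)) : ℝ :=
  M.lagr πs lam - M.lagr π lam

/-- The error of the estimated dual gradient at `lam`. -/
def gradErr (M : CMDP S A m) (τ μ : ℝ) (π : Policy S A) (lam : EuclideanSpace ℝ (Fin m)) :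
    EuclideanSpace ℝ (Fin m) :=
  M.gradEst μ π lam - gradient (M.dual τ μ) lam

/-- `K₀(lam)` for the initial points `lamB0` and `lam0`. -/
def K0 (M : CMDP S A m) (τ μ α η : ℝ) (lamB0 lam0 lam : EuclideanSpace ℝ (Fin m)) : ℝ :=
  M.dual τ μ lamB0 - M.dual τ μ lam + α / 2 * (μ + 1 / η) * ‖lam0 - lam‖ ^ 2

end CMDP

/-- The maximum of `f 1, …, f T`. -/
def maxUpTo (T : ℕ) (hT : 1 ≤ T) (f : ℕ → ℝ) : ℝ :=
  (Finset.Icc 1 T).sup' (Finset.nonempty_Icc.mpr hT) f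

/-- The constant `L_ν = ⌈log_β(C⁻¹)⌉ + (1 - β)⁻¹ + 1`. -/
def ergConst (C β : ℝ) : ℝ :=
  (⌈Real.logb β C⁻¹⌉ : ℝ) + (1 - β)⁻¹ + 1

end

/-!
The bounds come from one primal-dual certificate for the accelerated scheme, `CMDP.dual_average_le`:
for every multiplier `l` in the box, the dual value at the averaged multiplier `lamB T` is at most
the unregularized Lagrangian `L(πt, l)` of the output policy plus the largest solver errors, the
entropy bias `τ log |A| / (1 - γ)`, the quadratic bias `μ / 2 * ‖l‖ ^ 2` and an initial error which
decays like `(1 - α) ^ T`. It holds because the quadratic models of the dual function that the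
algorithm minimizes are, up to these errors, the Lagrangians of the policies `π t`
(`CMDP.dual_model_le`), and because the Lagrangian is affine in the occupancy measure, so that the
geometrically weighted average of the Lagrangians of the `π t` is the Lagrangian of `πt`
(`CMDP.visit_of_mixture`). The potential `d(lamB t) + μ / 2 * ‖l - lam t‖ ^ 2` then contracts by
`1 - α` in each step (`accelerated_step`).

Weak duality bounds the dual value below by the value of any feasible policy. The choice `l = 0`
gives the optimality gap. For the violation, `l` is `2 B` on the violated constraints and `0`
elsewhere, and the feasible policy is the mixture of `πt` with the Slater policy that is just
feasible (`CMDP.exists_feasible`); it loses at most `B` times the violation. The gradient errors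
enter linearly, and are absorbed by the square root in `ζ` because they are at most
`R_max / (1 - γ)` (`two_mul_le_sqrt_mul`). In particular no convergence of the multipliers is used.

The scheme needs the dual function to be `Ld`-smooth at the search points (`CMDP.dual_upper`). This
follows from the quadratic growth of the regularized Lagrangian at its maximizer
(`CMDP.regValue_growth`) in the expected `ℓ¹` distance of the policies. Growth is obtained by
comparing the optimal occupancy measure with its mixtures, which bounds a relative entropy, and
then a Pinsker inequality. In that distance the values are Lipschitz with a constant governed by the
mixing time of the optimal chain (`CMDP.abs_discounted_sub_le`), by the performance difference lemma.
The smoothness bound at a point compares with all other multipliers, and so also yields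
differentiability and Danskin's formula (`CMDP.gradient_dual`).
-/

namespace CMDP

variable {S A : Type*} [Fintype S] [Fintype A] {m : ℕ}

/-! ### Occupancy measures -/

lemma nonempty_state (M : CMDP S A m) : Nonempty S := by
  by_contra hne
  rw [not_nonempty_iff] at hne
  simpa using M.rho_mem.2

lemma nonempty_action (M : CMDP S A m) (π : Policy S A) : Nonempty A := by
  by_contra hne
  rw [not_nonempty_iff] at hne
  obtain ⟨s⟩ := M.nonempty_state
  simpa using (π.2 s).2

lemma sum_sum_eq_one (M : CMDP S A m) (π : Policy S A) (s : S) :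
    ∑ s', ∑ a, π.1 s a * M.P s a s' = 1 := by
  rw [Finset.sum_comm]
  simp_rw [← Finset.mul_sum, (M.P_mem s _).2, mul_one]
  exact (π.2 s).2

lemma stateDist_mem (M : CMDP S A m) (π : Policy S A) {p : S → ℝ} (hp : p ∈ stdSimplex ℝ S)
    (t : ℕ) : M.stateDist π p t ∈ stdSimplex ℝ S := by
  induction t with
  | zero => exact hp
  | succ t ih =>
    refine ⟨fun s' => Finset.sum_nonneg fun s _ => Finset.sum_nonneg fun a _ =>
      mul_nonneg (mul_nonneg (ih.1 s) ((π.2 s).1 a)) ((M.P_mem s a).1 s'), ?_⟩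
    simp only [stateDist]
    rw [Finset.sum_comm]
    simp_rw [mul_assoc, ← Finset.mul_sum, M.sum_sum_eq_one π, mul_one]
    exact ih.2

lemma le_one_of_mem {p : S → ℝ} (hp : p ∈ stdSimplex ℝ S) (s : S) : p s ≤ 1 := by
  rw [← hp.2]
  exact Finset.single_le_sum (f := p) (fun i _ => hp.1 i) (Finset.mem_univ s)

lemma summable_geom (M : CMDP S A m) : Summable fun t : ℕ => M.gam ^ t :=
  summable_geometric_of_lt_one M.gam_pos.le M.gam_lt_one

lemma one_sub_gam_pos (M : CMDP S A m) : 0 < 1 - M.gam := sub_pos.2 M.gam_lt_one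

/-- Discounted series of bounded sequences converge. -/
lemma summable_discount (M : CMDP S A m) {x : ℕ → ℝ} {K : ℝ} (hx : ∀ t, |x t| ≤ K) :
    Summable fun t : ℕ => M.gam ^ t * x t := by
  refine Summable.of_norm_bounded (M.summable_geom.mul_right K) fun t => ?_
  rw [Real.norm_eq_abs, abs_mul, abs_of_nonneg (pow_nonneg M.gam_pos.le t)]
  exact mul_le_mul_of_nonneg_left (hx t) (pow_nonneg M.gam_pos.le t)

lemma summable_stateDist (M : CMDP S A m) (π : Policy S A) {p : S → ℝ}
    (hp : p ∈ stdSimplex ℝ S) (s : S) :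
    Summable fun t : ℕ => M.gam ^ t * M.stateDist π p t s := by
  refine M.summable_discount (K := 1) fun t => ?_
  have h := M.stateDist_mem π hp t
  rw [abs_of_nonneg (h.1 s)]
  exact le_one_of_mem h s

lemma visit_eq_tsum_mul (M : CMDP S A m) (π : Policy S A) (s : S) (a : A) :
    M.visit π s a = (1 - M.gam) * (∑' t : ℕ, M.gam ^ t * M.stateDist π M.rho t s) * π.1 s a := by
  rw [visit, mul_assoc, ← tsum_mul_right]
  simp_rw [mul_assoc]

lemma stateVisit_eq_tsum (M : CMDP S A m) (π : Policy S A) (s : S) :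
    M.stateVisit π s = (1 - M.gam) * ∑' t : ℕ, M.gam ^ t * M.stateDist π M.rho t s := by
  simp_rw [stateVisit, visit_eq_tsum_mul, ← Finset.mul_sum, (π.2 s).2, mul_one]

lemma visit_eq (M : CMDP S A m) (π : Policy S A) (s : S) (a : A) :
    M.visit π s a = M.stateVisit π s * π.1 s a := by
  rw [visit_eq_tsum_mul, stateVisit_eq_tsum]

lemma stateVisit_nonneg (M : CMDP S A m) (π : Policy S A) (s : S) : 0 ≤ M.stateVisit π s := by
  rw [stateVisit_eq_tsum]
  exact mul_nonneg M.one_sub_gam_pos.le (tsum_nonneg fun t =>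
    mul_nonneg (pow_nonneg M.gam_pos.le t) ((M.stateDist_mem π M.rho_mem t).1 s))

lemma visit_nonneg (M : CMDP S A m) (π : Policy S A) (s : S) (a : A) : 0 ≤ M.visit π s a := by
  rw [visit_eq]
  exact mul_nonneg (M.stateVisit_nonneg π s) ((π.2 s).1 a)

/-- The balance equation characterizing discounted state visitation. -/
lemma stateVisit_flow (M : CMDP S A m) (π : Policy S A) (s' : S) :
    M.stateVisit π s' = (1 - M.gam) * M.rho s'
      + M.gam * ∑ s, ∑ a, M.visit π s a * M.P s a s' := by
  have hs := fun s => M.summable_stateDist π M.rho_mem s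
  rw [stateVisit_eq_tsum, (hs s').tsum_eq_zero_add]
  have h : ∑' t : ℕ, M.gam ^ (t + 1) * M.stateDist π M.rho (t + 1) s'
      = M.gam * ∑ s, ∑ a, (∑' t : ℕ, M.gam ^ t * M.stateDist π M.rho t s)
          * (π.1 s a * M.P s a s') := by
    simp_rw [← tsum_mul_right]
    have h2 : ∀ s, ∑ a, ∑' t : ℕ, M.gam ^ t * M.stateDist π M.rho t s * (π.1 s a * M.P s a s')
        = ∑' t : ℕ, ∑ a, M.gam ^ t * M.stateDist π M.rho t s * (π.1 s a * M.P s a s') :=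
      fun s => (Summable.tsum_finsetSum fun a _ => (hs s).mul_right _).symm
    simp_rw [h2]
    rw [← Summable.tsum_finsetSum fun s _ => summable_sum fun a _ => (hs s).mul_right _,
      ← tsum_mul_left]
    refine tsum_congr fun t => ?_
    simp only [stateDist, Finset.mul_sum]
    refine Finset.sum_congr rfl fun s _ => Finset.sum_congr rfl fun a _ => ?_
    ring
  rw [h]
  simp_rw [visit_eq_tsum_mul, Finset.mul_sum, stateDist, mul_add, Finset.mul_sum]
  congr 1
  · ring
  · refine Finset.sum_congr rfl fun s _ => Finset.sum_congr rfl fun a _ => ?_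
    ring

lemma sum_stateVisit (M : CMDP S A m) (π : Policy S A) : ∑ s, M.stateVisit π s = 1 := by
  simp_rw [stateVisit_eq_tsum, ← Finset.mul_sum]
  rw [← Summable.tsum_finsetSum fun s _ => M.summable_stateDist π M.rho_mem s]
  simp_rw [← Finset.mul_sum, (M.stateDist_mem π M.rho_mem _).2, mul_one]
  rw [tsum_geometric_of_lt_one M.gam_pos.le M.gam_lt_one]
  exact mul_inv_cancel₀ M.one_sub_gam_pos.ne'

/-- Expected discounted sums are integrals against the occupancy measure. -/
lemma discounted_eq (M : CMDP S A m) (π : Policy S A) (f : S → A → ℝ) :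
    (1 - M.gam) * M.discounted π f = ∑ s, ∑ a, M.visit π s a * f s a := by
  have hs := fun s => M.summable_stateDist π M.rho_mem s
  simp_rw [visit_eq_tsum_mul, mul_assoc, ← Finset.mul_sum]
  congr 1
  simp_rw [← tsum_mul_right]
  rw [← Summable.tsum_finsetSum fun s _ => (hs s).mul_right _, discounted]
  refine tsum_congr fun t => ?_
  simp only [Finset.mul_sum]
  refine Finset.sum_congr rfl fun s _ => Finset.sum_congr rfl fun a _ => ?_
  ring

lemma discounted_eq_div (M : CMDP S A m) (π : Policy S A) (f : S → A → ℝ) :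
    M.discounted π f = (∑ s, ∑ a, M.visit π s a * f s a) / (1 - M.gam) := by
  rw [eq_div_iff M.one_sub_gam_pos.ne', mul_comm, discounted_eq]

/-- The balance equation has a unique solution, because the discounted transition operator is a
strict `ℓ¹` contraction. -/
lemma eq_stateVisit_of_flow (M : CMDP S A m) (π : Policy S A) (x : S → ℝ)
    (hx : ∀ s', x s' = (1 - M.gam) * M.rho s'
      + M.gam * ∑ s, ∑ a, x s * π.1 s a * M.P s a s') : x = M.stateVisit π := by
  have key : ∑ s', |x s' - M.stateVisit π s'| ≤ M.gam * ∑ s, |x s - M.stateVisit π s| := by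
    have h1 : ∀ s', |x s' - M.stateVisit π s'|
        ≤ M.gam * ∑ s, |x s - M.stateVisit π s| * ∑ a, π.1 s a * M.P s a s' := by
      intro s'
      have : x s' - M.stateVisit π s'
          = M.gam * ∑ s, (x s - M.stateVisit π s) * ∑ a, π.1 s a * M.P s a s' := by
        rw [hx s', M.stateVisit_flow π s']
        simp_rw [visit_eq, sub_mul, Finset.sum_sub_distrib, mul_assoc, ← Finset.mul_sum]
        ring
      rw [this, abs_mul, abs_of_pos M.gam_pos]
      refine mul_le_mul_of_nonneg_left ((Finset.abs_sum_le_sum_abs _ _).trans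
        (Finset.sum_le_sum fun s _ => ?_)) M.gam_pos.le
      rw [abs_mul, abs_of_nonneg (Finset.sum_nonneg fun a _ =>
        mul_nonneg ((π.2 s).1 a) ((M.P_mem s a).1 s'))]
    refine (Finset.sum_le_sum fun s' _ => h1 s').trans_eq ?_
    rw [← Finset.mul_sum, Finset.sum_comm]
    simp_rw [← Finset.mul_sum, M.sum_sum_eq_one π, mul_one]
  have h0 : ∑ s', |x s' - M.stateVisit π s'| = 0 := by
    have hn : 0 ≤ ∑ s', |x s' - M.stateVisit π s'| := Finset.sum_nonneg fun _ _ => abs_nonneg _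
    nlinarith [M.gam_lt_one]
  funext s
  have := (Finset.sum_eq_zero_iff_of_nonneg fun _ _ => abs_nonneg _).1 h0 s (Finset.mem_univ s)
  exact sub_eq_zero.1 (abs_eq_zero.1 this)

/-- Convex combinations of occupancy measures are occupancy measures: the policy obtained by
disintegrating the combination realizes it. -/
lemma visit_of_mixture (M : CMDP S A m) {ι : Type*} (I : Finset ι) (w : ι → ℝ)
    (hw : ∀ i ∈ I, 0 ≤ w i) (hw1 : ∑ i ∈ I, w i = 1) (π : ι → Policy S A) (πt : Policy S A)
    (h : ∀ s, ∑ i ∈ I, w i * M.stateVisit (π i) s ≠ 0 → ∀ a, πt.1 s a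
      = (∑ i ∈ I, w i * M.visit (π i) s a) / ∑ i ∈ I, w i * M.stateVisit (π i) s) (s : S) (a : A) :
    M.visit πt s a = ∑ i ∈ I, w i * M.visit (π i) s a := by
  have hdis : ∀ s a, (∑ i ∈ I, w i * M.stateVisit (π i) s) * πt.1 s a
      = ∑ i ∈ I, w i * M.visit (π i) s a := by
    intro s a
    by_cases h0 : ∑ i ∈ I, w i * M.stateVisit (π i) s = 0
    · rw [h0, zero_mul, eq_comm]
      have := (Finset.sum_eq_zero_iff_of_nonneg fun i hi =>
        mul_nonneg (hw i hi) (M.stateVisit_nonneg (π i) s)).1 h0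
      refine Finset.sum_eq_zero fun i hi => ?_
      rw [visit_eq, ← mul_assoc, this i hi, zero_mul]
    · rw [h s h0 a, mul_div_cancel₀ _ h0]
  have hflow : (fun s => ∑ i ∈ I, w i * M.stateVisit (π i) s) = M.stateVisit πt := by
    refine M.eq_stateVisit_of_flow πt _ fun s' => ?_
    simp_rw [hdis, Finset.sum_mul]
    have e1 : ∑ s, ∑ a, ∑ i ∈ I, w i * M.visit (π i) s a * M.P s a s'
        = ∑ i ∈ I, w i * ∑ s, ∑ a, M.visit (π i) s a * M.P s a s' := by
      simp_rw [Finset.mul_sum]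
      rw [eq_comm, Finset.sum_comm]
      refine Finset.sum_congr rfl fun s _ => ?_
      rw [Finset.sum_comm]
      simp_rw [mul_assoc]
    rw [e1]
    conv_lhs => enter [2, i]; rw [M.stateVisit_flow (π i) s']
    simp_rw [mul_add, Finset.sum_add_distrib, Finset.mul_sum I]
    congr 1
    · rw [← Finset.sum_mul, hw1, one_mul]
    · refine Finset.sum_congr rfl fun i _ => ?_
      ring
  rw [visit_eq, ← hflow, hdis]

lemma discounted_of_mixture (M : CMDP S A m) {ι : Type*} (I : Finset ι) (w : ι → ℝ)
    (π : ι → Policy S A) (πt : Policy S A)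
    (h : ∀ s a, M.visit πt s a = ∑ i ∈ I, w i * M.visit (π i) s a) (f : S → A → ℝ) :
    M.discounted πt f = ∑ i ∈ I, w i * M.discounted (π i) f := by
  simp_rw [discounted_eq_div, h, mul_div_assoc', ← Finset.sum_div, Finset.mul_sum, Finset.sum_mul]
  congr 1
  rw [eq_comm, Finset.sum_comm]
  refine Finset.sum_congr rfl fun s _ => ?_
  rw [Finset.sum_comm]
  simp_rw [mul_assoc]

/-- Two-point mixtures of occupancy measures, together with the disintegration formula. -/
lemma exists_mixture (M : CMDP S A m) (π₀ π₁ : Policy S A) {θ : ℝ} (h0 : 0 ≤ θ) (h1 : θ ≤ 1) :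
    ∃ πt : Policy S A,
      (∀ s a, M.visit πt s a = (1 - θ) * M.visit π₀ s a + θ * M.visit π₁ s a) ∧
      (∀ s, M.stateVisit πt s = (1 - θ) * M.stateVisit π₀ s + θ * M.stateVisit π₁ s) ∧
      ∀ s, (1 - θ) * M.stateVisit π₀ s + θ * M.stateVisit π₁ s ≠ 0 → ∀ a,
        πt.1 s a = ((1 - θ) * M.visit π₀ s a + θ * M.visit π₁ s a)
          / ((1 - θ) * M.stateVisit π₀ s + θ * M.stateVisit π₁ s) := by
  classical
  let X : S → ℝ := fun s => (1 - θ) * M.stateVisit π₀ s + θ * M.stateVisit π₁ s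
  have hX : ∀ s, 0 ≤ X s := fun s => add_nonneg
    (mul_nonneg (sub_nonneg.2 h1) (M.stateVisit_nonneg _ s)) (mul_nonneg h0 (M.stateVisit_nonneg _ s))
  let πt : Policy S A := ⟨fun s a => if X s = 0 then π₀.1 s a else
      ((1 - θ) * M.visit π₀ s a + θ * M.visit π₁ s a) / X s, fun s => by
    by_cases h : X s = 0
    · simp only [h, if_true]; exact π₀.2 s
    · simp only [h, if_false]
      refine ⟨fun a => div_nonneg (add_nonneg (mul_nonneg (sub_nonneg.2 h1) (M.visit_nonneg _ s a))
        (mul_nonneg h0 (M.visit_nonneg _ s a))) (hX s), ?_⟩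
      rw [← Finset.sum_div, div_eq_one_iff_eq h, Finset.sum_add_distrib, ← Finset.mul_sum,
        ← Finset.mul_sum]
      rfl⟩
  have hπt : ∀ s, X s ≠ 0 → ∀ a, πt.1 s a
      = ((1 - θ) * M.visit π₀ s a + θ * M.visit π₁ s a) / X s := fun s h a => if_neg h
  have hv : ∀ s a, M.visit πt s a = (1 - θ) * M.visit π₀ s a + θ * M.visit π₁ s a := by
    intro s a
    have := M.visit_of_mixture (Finset.univ : Finset (Fin 2)) ![1 - θ, θ]
      (by intro i _; fin_cases i <;> simp [h0, h1]) (by simp) ![π₀, π₁] πt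
      (by simpa using hπt) s a
    simpa using this
  refine ⟨πt, hv, fun s => ?_, hπt⟩
  simp only [stateVisit, hv, Finset.sum_add_distrib, Finset.mul_sum]

end CMDP

/-! ### Relative entropy on a finite set -/

/-- A weak Pinsker inequality, obtained by comparing both sides with the Hellinger distance. -/
lemma sq_sum_abs_sub_le_kl {A : Type*} [Fintype A] {p q : A → ℝ} (hp : p ∈ stdSimplex ℝ A)
    (hq : q ∈ stdSimplex ℝ A) (h : ∀ a, q a = 0 → p a = 0) :
    (∑ a, |p a - q a|) ^ 2 / 4 ≤ ∑ a, p a * (Real.log (p a) - Real.log (q a)) := by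
  have h1 : ∀ a, p a - q a + (√(p a) - √(q a)) ^ 2
      ≤ p a * (Real.log (p a) - Real.log (q a)) := by
    intro a
    rcases (hp.1 a).eq_or_lt with h0 | h0
    · rw [← h0]; simp [Real.sq_sqrt (hq.1 a)]
    have hq0 : 0 < q a := (hq.1 a).lt_of_ne fun e => h0.ne' (h a e.symm)
    have hsp := Real.sqrt_pos.2 h0
    have hsq := Real.sqrt_pos.2 hq0
    have e1 : Real.log (√(q a) / √(p a)) = (Real.log (q a) - Real.log (p a)) / 2 := by
      rw [Real.log_div hsq.ne' hsp.ne', Real.log_sqrt h0.le, Real.log_sqrt hq0.le]; ring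
    have e2 := Real.log_le_sub_one_of_pos (div_pos hsq hsp)
    rw [e1] at e2
    have e3 : p a * (√(q a) / √(p a)) = √(p a) * √(q a) := by
      nth_rewrite 1 [← Real.sq_sqrt h0.le]; field_simp
    nlinarith [Real.sq_sqrt h0.le, Real.sq_sqrt hq0.le]
  have h2 : ∑ a, (√(p a) - √(q a)) ^ 2 ≤ ∑ a, p a * (Real.log (p a) - Real.log (q a)) := by
    refine le_trans (le_of_eq ?_) (Finset.sum_le_sum fun a _ => h1 a)
    rw [Finset.sum_add_distrib, Finset.sum_sub_distrib, hp.2, hq.2]; ring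
  have h3 : ∑ a, (√(p a) + √(q a)) ^ 2 ≤ 4 := by
    calc ∑ a, (√(p a) + √(q a)) ^ 2 ≤ ∑ a, (2 * p a + 2 * q a) :=
          Finset.sum_le_sum fun a _ => by
            nlinarith [Real.sq_sqrt (hp.1 a), Real.sq_sqrt (hq.1 a), sq_nonneg (√(p a) - √(q a))]
      _ = 4 := by rw [Finset.sum_add_distrib, ← Finset.mul_sum, ← Finset.mul_sum, hp.2, hq.2]; ring
  have h4 : ∑ a, |p a - q a| = ∑ a, |√(p a) - √(q a)| * (√(p a) + √(q a)) := by
    refine Finset.sum_congr rfl fun a _ => ?_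
    nth_rewrite 1 [← Real.sq_sqrt (hp.1 a), ← Real.sq_sqrt (hq.1 a)]
    rw [sq_sub_sq, abs_mul, mul_comm,
      abs_of_nonneg (add_nonneg (Real.sqrt_nonneg _) (Real.sqrt_nonneg _))]
  have h5 := Finset.sum_mul_sq_le_sq_mul_sq Finset.univ (fun a => |√(p a) - √(q a)|)
    (fun a => √(p a) + √(q a))
  simp only [sq_abs] at h5
  rw [← h4] at h5
  have h6 : 0 ≤ ∑ a, (√(p a) - √(q a)) ^ 2 := Finset.sum_nonneg fun _ _ => sq_nonneg _
  nlinarith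

namespace CMDP

variable {S A : Type*} [Fintype S] [Fintype A] {m : ℕ}

/-! ### Quadratic growth of the entropy-regularized objective -/

/-- The entropy-regularized value of a policy for the reward function `f`. -/
noncomputable def regValue (M : CMDP S A m) (τ : ℝ) (f : S → A → ℝ) (π : Policy S A) : ℝ :=
  M.discounted π f + τ * M.entropy π

lemma regValue_eq (M : CMDP S A m) (τ : ℝ) (f : S → A → ℝ) (π : Policy S A) :
    (1 - M.gam) * M.regValue τ f π
      = ∑ s, ∑ a, M.visit π s a * (f s a - τ * Real.log (π.1 s a)) := by
  rw [regValue, entropy, mul_add, mul_left_comm, discounted_eq, discounted_eq, Finset.mul_sum,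
    ← Finset.sum_add_distrib]
  refine Finset.sum_congr rfl fun s _ => ?_
  rw [Finset.mul_sum, ← Finset.sum_add_distrib]
  exact Finset.sum_congr rfl fun a _ => by ring

/-- Optimality of `πs` against the mixtures of its occupancy measure with that of `π` bounds the
relative entropy of `π` with respect to the mixture policy. -/
lemma regValue_add_kl_le (M : CMDP S A m) {τ : ℝ} (hτ : 0 < τ) (f : S → A → ℝ)
    (πs π : Policy S A) (hopt : ∀ π', M.regValue τ f π' ≤ M.regValue τ f πs)
    {θ : ℝ} (h0 : 0 < θ) (h1 : θ < 1) (πt : Policy S A)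
    (hv : ∀ s a, M.visit πt s a = (1 - θ) * M.visit πs s a + θ * M.visit π s a) :
    (1 - M.gam) * M.regValue τ f π + τ * ∑ s, M.stateVisit π s *
        ∑ a, π.1 s a * (Real.log (π.1 s a) - Real.log (πt.1 s a))
      ≤ (1 - M.gam) * M.regValue τ f πs := by
  have split : ∀ ρ : Policy S A,
      ∑ s, ∑ a, M.visit ρ s a * (f s a - τ * Real.log (πt.1 s a))
        = (1 - M.gam) * M.regValue τ f ρ + τ * ∑ s, M.stateVisit ρ s *
          ∑ a, ρ.1 s a * (Real.log (ρ.1 s a) - Real.log (πt.1 s a)) := by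
    intro ρ
    rw [regValue_eq, Finset.mul_sum, ← Finset.sum_add_distrib]
    refine Finset.sum_congr rfl fun s _ => ?_
    rw [Finset.mul_sum, Finset.mul_sum, ← Finset.sum_add_distrib]
    refine Finset.sum_congr rfl fun a _ => ?_
    rw [visit_eq]; ring
  have hnn : 0 ≤ ∑ s, M.stateVisit πs s *
      ∑ a, πs.1 s a * (Real.log (πs.1 s a) - Real.log (πt.1 s a)) := by
    refine Finset.sum_nonneg fun s _ => ?_
    rcases (M.stateVisit_nonneg πs s).eq_or_lt with hs | hs
    · rw [← hs, zero_mul]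
    refine mul_nonneg hs.le (le_trans (by positivity)
      (sq_sum_abs_sub_le_kl (πs.2 s) (πt.2 s) fun a ha => ?_))
    have e := hv s a
    rw [visit_eq, ha, mul_zero, visit_eq M πs] at e
    have e1 : 0 ≤ θ * M.visit π s a := mul_nonneg h0.le (M.visit_nonneg π s a)
    have e2 : 0 ≤ (1 - θ) * (M.stateVisit πs s * πs.1 s a) :=
      mul_nonneg (sub_nonneg.2 h1.le) (mul_nonneg hs.le ((πs.2 s).1 a))
    have e3 : (1 - θ) * (M.stateVisit πs s * πs.1 s a) = 0 := by linarith
    simpa [(sub_pos.2 h1).ne', hs.ne'] using e3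
  have hmix : (1 - M.gam) * M.regValue τ f πt
      = (1 - θ) * ∑ s, ∑ a, M.visit πs s a * (f s a - τ * Real.log (πt.1 s a))
        + θ * ∑ s, ∑ a, M.visit π s a * (f s a - τ * Real.log (πt.1 s a)) := by
    rw [regValue_eq, Finset.mul_sum, Finset.mul_sum, ← Finset.sum_add_distrib]
    refine Finset.sum_congr rfl fun s _ => ?_
    rw [Finset.mul_sum, Finset.mul_sum, ← Finset.sum_add_distrib]
    refine Finset.sum_congr rfl fun a _ => ?_
    rw [hv]; ring
  have hle := mul_le_mul_of_nonneg_left (hopt πt) M.one_sub_gam_pos.le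
  rw [hmix, split πs, split π] at hle
  have h2 : 0 ≤ (1 - θ) * (τ * ∑ s, M.stateVisit πs s *
      ∑ a, πs.1 s a * (Real.log (πs.1 s a) - Real.log (πt.1 s a))) :=
    mul_nonneg (sub_nonneg.2 h1.le) (mul_nonneg hτ.le hnn)
  refine le_of_mul_le_mul_left ?_ h0
  linarith

/-- The mixture policy is absolutely continuous with respect to its second component. -/
lemma eq_zero_of_mixture_eq_zero (M : CMDP S A m) {πs π πt : Policy S A} {θ : ℝ} (h0 : 0 < θ)
    (h1 : θ < 1) (hv : ∀ s a, M.visit πt s a = (1 - θ) * M.visit πs s a + θ * M.visit π s a)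
    {s : S} (hs : 0 < M.stateVisit π s) {a : A} (ha : πt.1 s a = 0) : π.1 s a = 0 := by
  have e := hv s a
  rw [visit_eq, ha, mul_zero, visit_eq M π] at e
  have e1 : 0 ≤ (1 - θ) * M.visit πs s a := mul_nonneg (sub_nonneg.2 h1.le) (M.visit_nonneg πs s a)
  have e2 : 0 ≤ θ * (M.stateVisit π s * π.1 s a) :=
    mul_nonneg h0.le (mul_nonneg hs.le ((π.2 s).1 a))
  have e3 : θ * (M.stateVisit π s * π.1 s a) = 0 := by linarith
  simpa [h0.ne', hs.ne'] using e3

lemma tendsto_mixture (M : CMDP S A m) (πs π : Policy S A) {s : S}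
    (hs : M.stateVisit πs s ≠ 0) (a : A) :
    Filter.Tendsto (fun θ : ℝ => ((1 - θ) * M.visit πs s a + θ * M.visit π s a)
      / ((1 - θ) * M.stateVisit πs s + θ * M.stateVisit π s)) (nhdsWithin 0 (Set.Ioi 0))
      (nhds (πs.1 s a)) := by
  have hc : ContinuousAt (fun θ : ℝ => ((1 - θ) * M.visit πs s a + θ * M.visit π s a)
      / ((1 - θ) * M.stateVisit πs s + θ * M.stateVisit π s)) 0 := by
    refine ContinuousAt.div (by fun_prop) (by fun_prop) (by simpa using hs)
  have := hc.tendsto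
  simp only [sub_zero, one_mul, zero_mul, add_zero] at this
  rw [show M.visit πs s a / M.stateVisit πs s = πs.1 s a by
    rw [visit_eq, mul_div_cancel_left₀ _ hs]] at this
  exact this.mono_left nhdsWithin_le_nhds

lemma eventually_Ioo : ∀ᶠ θ : ℝ in nhdsWithin 0 (Set.Ioi 0), θ ∈ Set.Ioo (0 : ℝ) 1 :=
  Ioo_mem_nhdsGT one_pos

/-- A regularized optimal policy gives positive weight to every action that some policy uses,
since the entropy has infinite slope at the boundary of the simplex. -/
lemma pos_of_visit_pos (M : CMDP S A m) {τ : ℝ} (hτ : 0 < τ) (f : S → A → ℝ)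
    (πs π : Policy S A) (hopt : ∀ π', M.regValue τ f π' ≤ M.regValue τ f πs) {s : S} {a : A}
    (hs : 0 < M.stateVisit πs s) (hv : 0 < M.visit π s a) : 0 < πs.1 s a := by
  have hX : 0 < M.stateVisit π s := by
    refine (M.stateVisit_nonneg π s).lt_of_ne fun e => hv.ne' ?_
    rw [visit_eq, ← e, zero_mul]
  have hpa : 0 < π.1 s a := by
    refine ((π.2 s).1 a).lt_of_ne fun e => hv.ne' ?_
    rw [visit_eq, ← e, mul_zero]
  set c := (1 - M.gam) * M.regValue τ f πs - (1 - M.gam) * M.regValue τ f π with hc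
  set h := ∑ b, π.1 s b * Real.log (π.1 s b) with hh
  have key : ∀ θ ∈ Set.Ioo (0 : ℝ) 1, Real.exp (-((c / (τ * M.stateVisit π s) - h) / π.1 s a)) ≤
      ((1 - θ) * M.visit πs s a + θ * M.visit π s a)
      / ((1 - θ) * M.stateVisit πs s + θ * M.stateVisit π s) := by
    intro θ hθ
    obtain ⟨πt, hvt, -, hdis⟩ := M.exists_mixture πs π hθ.1.le hθ.2.le
    have hden : 0 < (1 - θ) * M.stateVisit πs s + θ * M.stateVisit π s :=
      add_pos (mul_pos (sub_pos.2 hθ.2) hs) (mul_pos hθ.1 hX)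
    rw [← hdis s hden.ne' a]
    have hta : 0 < πt.1 s a := ((πt.2 s).1 a).lt_of_ne fun e =>
      hpa.ne' (M.eq_zero_of_mixture_eq_zero hθ.1 hθ.2 hvt hX e.symm)
    rw [← Real.le_log_iff_exp_le hta]
    have h1 := M.regValue_add_kl_le hτ f πs π hopt hθ.1 hθ.2 πt hvt
    have h2 : M.stateVisit π s * ∑ b, π.1 s b * (Real.log (π.1 s b) - Real.log (πt.1 s b))
        ≤ ∑ s, M.stateVisit π s *
          ∑ a, π.1 s a * (Real.log (π.1 s a) - Real.log (πt.1 s a)) := by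
      refine Finset.single_le_sum (f := fun s => M.stateVisit π s *
          ∑ a, π.1 s a * (Real.log (π.1 s a) - Real.log (πt.1 s a))) (fun s _ => ?_)
          (Finset.mem_univ s)
      rcases (M.stateVisit_nonneg π s).eq_or_lt with hs | hs
      · simp [← hs]
      exact mul_nonneg hs.le (le_trans (by positivity) (sq_sum_abs_sub_le_kl (π.2 s) (πt.2 s)
        fun a ha => M.eq_zero_of_mixture_eq_zero hθ.1 hθ.2 hvt hs ha))
    have h3 : h - π.1 s a * Real.log (πt.1 s a)
        ≤ ∑ b, π.1 s b * (Real.log (π.1 s b) - Real.log (πt.1 s b)) := by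
      simp_rw [mul_sub, Finset.sum_sub_distrib, ← hh]
      have : π.1 s a * -Real.log (πt.1 s a) ≤ ∑ b, π.1 s b * -Real.log (πt.1 s b) :=
        Finset.single_le_sum (f := fun b => π.1 s b * -Real.log (πt.1 s b))
          (fun b _ => mul_nonneg ((π.2 s).1 b) (neg_nonneg.2 (Real.log_nonpos ((πt.2 s).1 b)
            (le_one_of_mem (πt.2 s) b)))) (Finset.mem_univ a)
      simp only [mul_neg, Finset.sum_neg_distrib] at this
      linarith
    have h4 : τ * (M.stateVisit π s * (h - π.1 s a * Real.log (πt.1 s a))) ≤ c := by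
      have := mul_le_mul_of_nonneg_left ((mul_le_mul_of_nonneg_left h3 hX.le).trans h2) hτ.le
      linarith
    have h5 : h - π.1 s a * Real.log (πt.1 s a) ≤ c / (τ * M.stateVisit π s) := by
      rw [le_div_iff₀ (mul_pos hτ hX)]; linarith
    rw [neg_le, le_div_iff₀ hpa]
    linarith
  have h6 := ge_of_tendsto (M.tendsto_mixture πs π hs.ne' a) (eventually_Ioo.mono key)
  exact (Real.exp_pos _).trans_le h6

lemma stateVisit_pos_of_stateDist_pos (M : CMDP S A m) (π : Policy S A) {t : ℕ} {s : S}
    (h : 0 < M.stateDist π M.rho t s) : 0 < M.stateVisit π s := by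
  rw [stateVisit_eq_tsum]
  refine mul_pos M.one_sub_gam_pos ((M.summable_stateDist π M.rho_mem s).tsum_pos
    (fun t => mul_nonneg (pow_nonneg M.gam_pos.le t) ((M.stateDist_mem π M.rho_mem t).1 s)) t
    (mul_pos (pow_pos M.gam_pos t) h))

/-- Every state visited by some policy is visited by a regularized optimal policy. -/
lemma stateVisit_eq_zero_of_opt (M : CMDP S A m) {τ : ℝ} (hτ : 0 < τ) (f : S → A → ℝ)
    (πs π : Policy S A) (hopt : ∀ π', M.regValue τ f π' ≤ M.regValue τ f πs) {s : S}
    (hs : M.stateVisit πs s = 0) : M.stateVisit π s = 0 := by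
  have key : ∀ t s, 0 < M.stateDist π M.rho t s → 0 < M.stateVisit πs s := by
    intro t
    induction t with
    | zero =>
      intro s hs
      exact M.stateVisit_pos_of_stateDist_pos πs (t := 0) hs
    | succ t ih =>
      intro s' hs'
      rw [stateDist] at hs'
      obtain ⟨s, -, h1⟩ := Finset.exists_lt_of_sum_lt (s := Finset.univ) (f := fun _ : S => (0 : ℝ))
        (by simpa using hs')
      obtain ⟨a, -, h2⟩ := Finset.exists_lt_of_sum_lt (s := Finset.univ) (f := fun _ : A => (0 : ℝ))
        (by simpa using h1)
      have hp := (M.stateDist_mem π M.rho_mem t).1 s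
      have ha := (π.2 s).1 a
      have hP := (M.P_mem s a).1 s'
      have hp' : 0 < M.stateDist π M.rho t s := hp.lt_of_ne fun e => by simp [← e] at h2
      have ha' : 0 < π.1 s a := ha.lt_of_ne fun e => by simp [← e] at h2
      have hP' : 0 < M.P s a s' := hP.lt_of_ne fun e => by simp [← e] at h2
      have hX := ih s hp'
      have hν : 0 < M.visit π s a := by
        rw [visit_eq]; exact mul_pos (M.stateVisit_pos_of_stateDist_pos π hp') ha'
      have hπs := M.pos_of_visit_pos hτ f πs π hopt hX hν
      have h3 : M.visit πs s a * M.P s a s' ≤ ∑ s, ∑ a, M.visit πs s a * M.P s a s' :=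
        (Finset.single_le_sum (f := fun a => M.visit πs s a * M.P s a s')
          (fun a _ => mul_nonneg (M.visit_nonneg πs s a) ((M.P_mem s a).1 s'))
          (Finset.mem_univ a)).trans
        (Finset.single_le_sum (f := fun s => ∑ a, M.visit πs s a * M.P s a s')
          (fun s _ => Finset.sum_nonneg fun a _ =>
            mul_nonneg (M.visit_nonneg πs s a) ((M.P_mem s a).1 s')) (Finset.mem_univ s))
      rw [M.stateVisit_flow πs s']
      refine add_pos_of_nonneg_of_pos (mul_nonneg M.one_sub_gam_pos.le (M.rho_mem.1 s'))
        (mul_pos M.gam_pos (lt_of_lt_of_le (mul_pos ?_ hP') h3))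
      rw [visit_eq]
      exact mul_pos hX hπs
  by_contra hne
  rw [stateVisit_eq_tsum] at hne
  obtain ⟨t, ht⟩ : ∃ t, M.stateDist π M.rho t s ≠ 0 := by
    by_contra! hall
    simp [hall] at hne
  exact (key t s (((M.stateDist_mem π M.rho_mem t).1 s).lt_of_ne' ht)).ne' hs

/-- Quadratic growth of the regularized objective away from its maximizer, in the expected `ℓ¹`
distance of the policies. -/
lemma regValue_growth (M : CMDP S A m) {τ : ℝ} (hτ : 0 < τ) (f : S → A → ℝ)
    (πs π : Policy S A) (hopt : ∀ π', M.regValue τ f π' ≤ M.regValue τ f πs) :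
    τ / 4 * (∑ s, M.stateVisit π s * ∑ a, |π.1 s a - πs.1 s a|) ^ 2
      ≤ (1 - M.gam) * (M.regValue τ f πs - M.regValue τ f π) := by
  have key : ∀ θ ∈ Set.Ioo (0 : ℝ) 1, τ / 4 * ∑ s, M.stateVisit π s * (∑ a, |π.1 s a -
      ((1 - θ) * M.visit πs s a + θ * M.visit π s a)
      / ((1 - θ) * M.stateVisit πs s + θ * M.stateVisit π s)|) ^ 2
      ≤ (1 - M.gam) * (M.regValue τ f πs - M.regValue τ f π) := by
    intro θ hθ
    obtain ⟨πt, hvt, -, hdis⟩ := M.exists_mixture πs π hθ.1.le hθ.2.le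
    have h1 := M.regValue_add_kl_le hτ f πs π hopt hθ.1 hθ.2 πt hvt
    have h2 : ∑ s, M.stateVisit π s * (∑ a, |π.1 s a -
      ((1 - θ) * M.visit πs s a + θ * M.visit π s a)
      / ((1 - θ) * M.stateVisit πs s + θ * M.stateVisit π s)|) ^ 2
      ≤ 4 * ∑ s, M.stateVisit π s *
        ∑ a, π.1 s a * (Real.log (π.1 s a) - Real.log (πt.1 s a)) := by
      rw [Finset.mul_sum]
      refine Finset.sum_le_sum fun s _ => ?_
      rcases (M.stateVisit_nonneg π s).eq_or_lt with hs | hs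
      · simp [← hs]
      have hden : 0 < (1 - θ) * M.stateVisit πs s + θ * M.stateVisit π s :=
        add_pos_of_nonneg_of_pos (mul_nonneg (sub_nonneg.2 hθ.2.le) (M.stateVisit_nonneg πs s))
          (mul_pos hθ.1 hs)
      simp_rw [← hdis s hden.ne']
      have := mul_le_mul_of_nonneg_left (sq_sum_abs_sub_le_kl (π.2 s) (πt.2 s)
        fun a ha => M.eq_zero_of_mixture_eq_zero hθ.1 hθ.2 hvt hs ha) hs.le
      linarith
    have h3 := mul_le_mul_of_nonneg_left h2 hτ.le
    linarith
  have hlim : Filter.Tendsto (fun θ : ℝ => τ / 4 * ∑ s, M.stateVisit π s * (∑ a, |π.1 s a -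
      ((1 - θ) * M.visit πs s a + θ * M.visit π s a)
      / ((1 - θ) * M.stateVisit πs s + θ * M.stateVisit π s)|) ^ 2) (nhdsWithin 0 (Set.Ioi 0))
      (nhds (τ / 4 * ∑ s, M.stateVisit π s * (∑ a, |π.1 s a - πs.1 s a|) ^ 2)) := by
    refine Filter.Tendsto.const_mul _ (tendsto_finsetSum _ fun s _ => ?_)
    by_cases hs : M.stateVisit πs s = 0
    · simp [M.stateVisit_eq_zero_of_opt hτ f πs π hopt hs]
    · exact ((tendsto_finsetSum _ fun a _ =>
        ((M.tendsto_mixture πs π hs a).const_sub _).abs).pow 2).const_mul _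
  refine le_trans (mul_le_mul_of_nonneg_left ?_ (by positivity))
    (le_of_tendsto hlim (eventually_Ioo.mono key))
  -- Jensen's inequality for the square and the probability vector `M.stateVisit π`
  have hJ := (convexOn_pow 2 : ConvexOn ℝ (Set.Ici 0) fun x : ℝ => x ^ 2).map_sum_le
    (t := Finset.univ) (w := fun s => M.stateVisit π s) (p := fun s => ∑ a, |π.1 s a - πs.1 s a|)
    (fun s _ => M.stateVisit_nonneg π s) (M.sum_stateVisit π)
    (fun s _ => Set.mem_Ici.2 (Finset.sum_nonneg fun _ _ => abs_nonneg _))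
  simpa using hJ

end CMDP

/-! ### Sensitivity of values under uniform ergodicity -/

/-- A signed measure of total mass zero integrates a function of oscillation at most `D` to at
most `D / 2` times its total variation. -/
lemma abs_sum_mul_le_of_sum_eq_zero {ι : Type*} [Fintype ι] {e g : ι → ℝ} (he : ∑ i, e i = 0)
    {l D : ℝ} (hl : ∀ i, l ≤ g i) (hu : ∀ i, g i ≤ l + D) :
    |∑ i, e i * g i| ≤ D / 2 * ∑ i, |e i| := by
  have h1 : ∑ i, e i * g i = ∑ i, e i * (g i - (l + D / 2)) := by
    simp_rw [mul_sub, Finset.sum_sub_distrib, ← Finset.sum_mul, he]; ring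
  rw [h1, Finset.mul_sum]
  refine (Finset.abs_sum_le_sum_abs _ _).trans (Finset.sum_le_sum fun i _ => ?_)
  rw [abs_mul, mul_comm]
  exact mul_le_mul_of_nonneg_right (abs_le.2 ⟨by linarith [hl i], by linarith [hu i]⟩)
    (abs_nonneg _)

namespace CMDP

variable {S A : Type*} [Fintype S] [Fintype A] {m : ℕ}

lemma single_mem [DecidableEq S] (s : S) : Pi.single s (1 : ℝ) ∈ stdSimplex ℝ S :=
  single_mem_stdSimplex ℝ s

lemma dTV_le_one {p p' : S → ℝ} (hp : p ∈ stdSimplex ℝ S) (hp' : p' ∈ stdSimplex ℝ S) :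
    dTV p p' ≤ 1 := by
  have h : ∑ s, |p s - p' s| ≤ ∑ s, (p s + p' s) := Finset.sum_le_sum fun s _ =>
    abs_le.2 ⟨by linarith [hp.1 s, hp'.1 s], by linarith [hp.1 s, hp'.1 s]⟩
  rw [Finset.sum_add_distrib, hp.2, hp'.2] at h
  rw [dTV]; linarith

lemma dTV_triangle (p q p' : S → ℝ) : dTV p p' ≤ dTV p q + dTV p' q := by
  rw [dTV, dTV, dTV, ← mul_add, ← Finset.sum_add_distrib]
  refine mul_le_mul_of_nonneg_left (Finset.sum_le_sum fun s _ => ?_) (by norm_num)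
  rw [abs_sub_comm (p' s)]
  exact abs_sub_le _ _ _

/-- First-step decomposition of the law of the chain, as opposed to the last-step recursion that
defines `stateDist`. -/
lemma stateDist_succ_eq_sum [DecidableEq S] (M : CMDP S A m) (π : Policy S A) (p : S → ℝ)
    (t : ℕ) (x : S) : M.stateDist π p (t + 1) x
      = ∑ s, ∑ a, p s * π.1 s a * ∑ s', M.P s a s' * M.stateDist π (Pi.single s' 1) t x := by
  induction t generalizing x with
  | zero =>
    simp only [stateDist]
    refine Finset.sum_congr rfl fun s _ => Finset.sum_congr rfl fun a _ => ?_
    congr 1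
    simp [Pi.single_apply]
  | succ t ih =>
    rw [stateDist]
    simp_rw [ih]
    simp only [stateDist, Finset.mul_sum, Finset.sum_mul]
    -- both sides sum over the present state-action pair, the next state and a later pair
    calc _ = ∑ y, ∑ s, ∑ b, ∑ a, ∑ s', p s * π.1 s a
            * (M.P s a s' * (M.stateDist π (Pi.single s' 1) t y * π.1 y b * M.P y b x)) := by
          refine Finset.sum_congr rfl fun y _ => ?_
          rw [Finset.sum_comm]
          refine Finset.sum_congr rfl fun s _ => Finset.sum_congr rfl fun b _ =>
            Finset.sum_congr rfl fun a _ => Finset.sum_congr rfl fun s' _ => ?_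
          ring
      _ = ∑ s, ∑ y, ∑ a, ∑ s', ∑ b, p s * π.1 s a
            * (M.P s a s' * (M.stateDist π (Pi.single s' 1) t y * π.1 y b * M.P y b x)) := by
          rw [Finset.sum_comm]
          refine Finset.sum_congr rfl fun s _ => Finset.sum_congr rfl fun y _ => ?_
          rw [Finset.sum_comm]
          refine Finset.sum_congr rfl fun a _ => ?_
          rw [Finset.sum_comm]
      _ = _ := by
          refine Finset.sum_congr rfl fun s _ => ?_
          rw [Finset.sum_comm]
          refine Finset.sum_congr rfl fun a _ => ?_
          rw [Finset.sum_comm]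

/-- The expected discounted reward of the stationary policy `π` started in the state `s`. -/
noncomputable def stateValue [DecidableEq S] (M : CMDP S A m) (π : Policy S A) (f : S → A → ℝ) (s : S) : ℝ :=
  ∑' t : ℕ, M.gam ^ t * ∑ x, M.stateDist π (Pi.single s 1) t x * ∑ a, π.1 x a * f x a

lemma summable_stateValue [DecidableEq S] (M : CMDP S A m) (π : Policy S A) (f : S → A → ℝ)
    (s : S) : Summable fun t : ℕ =>
      M.gam ^ t * ∑ x, M.stateDist π (Pi.single s 1) t x * ∑ a, π.1 x a * f x a := by
  simp_rw [Finset.mul_sum (Finset.univ : Finset S), ← mul_assoc]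
  exact summable_sum fun x _ => (M.summable_stateDist π (single_mem s) x).mul_right _

/-- The state-action value function associated with `stateValue`. -/
noncomputable def actionValue [DecidableEq S] (M : CMDP S A m) (π : Policy S A) (f : S → A → ℝ) (s : S)
    (a : A) : ℝ :=
  f s a + M.gam * ∑ s', M.P s a s' * M.stateValue π f s'

/-- The Bellman equation. -/
lemma stateValue_eq [DecidableEq S] (M : CMDP S A m) (π : Policy S A) (f : S → A → ℝ) (s : S) :
    M.stateValue π f s = ∑ a, π.1 s a * M.actionValue π f s a := by
  have hs := M.summable_stateValue π f
  rw [stateValue, (hs s).tsum_eq_zero_add]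
  simp_rw [actionValue, mul_add, Finset.sum_add_distrib]
  congr 1
  · simp [stateDist, Pi.single_apply]
  · have h : ∀ a, π.1 s a * (M.gam * ∑ s', M.P s a s' * M.stateValue π f s')
        = ∑' t : ℕ, ∑ s', π.1 s a * M.gam * M.P s a s' * (M.gam ^ t *
          ∑ x, M.stateDist π (Pi.single s' 1) t x * ∑ a, π.1 x a * f x a) := by
      intro a
      rw [Summable.tsum_finsetSum fun s' _ => (hs s').mul_left _]
      rw [Finset.mul_sum, Finset.mul_sum]
      refine Finset.sum_congr rfl fun s' _ => ?_
      rw [tsum_mul_left, stateValue]; ring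
    simp_rw [h]
    rw [← Summable.tsum_finsetSum fun a _ => summable_sum fun s' _ => (hs s').mul_left _]
    refine tsum_congr fun t => ?_
    have hstep : ∀ x, M.stateDist π (Pi.single s 1) (t + 1) x
        = ∑ a, π.1 s a * ∑ s', M.P s a s' * M.stateDist π (Pi.single s' 1) t x := fun x => by
      rw [stateDist_succ_eq_sum, Finset.sum_comm]
      simp [Pi.single_apply]
    simp_rw [hstep, Finset.sum_mul, Finset.mul_sum (Finset.univ : Finset S), Finset.mul_sum,
      Finset.sum_mul, Finset.mul_sum]
    rw [Finset.sum_comm]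
    refine Finset.sum_congr rfl fun a _ => ?_
    conv_rhs => rw [Finset.sum_comm]
    refine Finset.sum_congr rfl fun x _ => ?_
    rw [Finset.sum_comm]
    refine Finset.sum_congr rfl fun s' _ => Finset.sum_congr rfl fun b _ => ?_
    ring

/-- The performance difference lemma. -/
lemma discounted_sub (M : CMDP S A m) [DecidableEq S] (π πs : Policy S A) (f : S → A → ℝ) :
    (1 - M.gam) * (M.discounted π f - M.discounted πs f)
      = ∑ s, M.stateVisit π s * ∑ a, (π.1 s a - πs.1 s a) * M.actionValue πs f s a := by
  -- Integrate the temporal difference of `stateValue` against an occupancy measure.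
  have key : ∀ ρ : Policy S A, (1 - M.gam) * M.discounted ρ f
      = ∑ s, M.stateVisit ρ s * (∑ a, ρ.1 s a * M.actionValue πs f s a - M.stateValue πs f s)
        + (1 - M.gam) * ∑ s, M.rho s * M.stateValue πs f s := by
    intro ρ
    have h1 : ∑ s, M.stateVisit ρ s * M.stateValue πs f s
        = (1 - M.gam) * ∑ s, M.rho s * M.stateValue πs f s
          + M.gam * ∑ s, ∑ a, M.visit ρ s a * ∑ s', M.P s a s' * M.stateValue πs f s' := by
      conv_lhs => enter [2, s]; rw [M.stateVisit_flow ρ s]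
      simp_rw [add_mul, Finset.sum_add_distrib, mul_assoc, ← Finset.mul_sum]
      congr 2
      simp_rw [Finset.sum_mul, Finset.mul_sum]
      rw [Finset.sum_comm]
      refine Finset.sum_congr rfl fun s _ => ?_
      rw [Finset.sum_comm]
      refine Finset.sum_congr rfl fun s _ => Finset.sum_congr rfl fun s _ => ?_
      ring
    have h2 : ∑ s, M.stateVisit ρ s * ∑ a, ρ.1 s a * M.actionValue πs f s a
        = (1 - M.gam) * M.discounted ρ f
          + M.gam * ∑ s, ∑ a, M.visit ρ s a * ∑ s', M.P s a s' * M.stateValue πs f s' := by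
      rw [discounted_eq, Finset.mul_sum, ← Finset.sum_add_distrib]
      refine Finset.sum_congr rfl fun s _ => ?_
      rw [Finset.mul_sum, Finset.mul_sum, ← Finset.sum_add_distrib]
      refine Finset.sum_congr rfl fun a _ => ?_
      rw [actionValue, visit_eq]; ring
    simp_rw [mul_sub, Finset.sum_sub_distrib]
    rw [h1, h2]; ring
  rw [mul_sub, key π, key πs, add_sub_add_right_eq_sub, ← Finset.sum_sub_distrib]
  refine Finset.sum_congr rfl fun s _ => ?_
  simp_rw [sub_mul, Finset.sum_sub_distrib, stateValue_eq]; ring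

/-- The discounted sum of the bounds `min 1 (2 C βᵗ)` on the total variation distance of two
copies of a uniformly ergodic chain. -/
noncomputable def mixSum (M : CMDP S A m) (C β : ℝ) : ℝ := M.gam * ∑' t : ℕ, M.gam ^ t * min 1 (2 * C * β ^ t)

section mixSum

variable (M : CMDP S A m) {C β : ℝ}

lemma abs_min_le (hC : 0 < C) (hβ0 : 0 < β) (t : ℕ) : |min 1 (2 * C * β ^ t)| ≤ 1 := by
  rw [abs_of_nonneg (le_min zero_le_one (by positivity))]
  exact min_le_left _ _

lemma mixSum_nonneg (hC : 0 < C) (hβ0 : 0 < β) : 0 ≤ M.mixSum C β :=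
  mul_nonneg M.gam_pos.le (tsum_nonneg fun t => mul_nonneg (pow_nonneg M.gam_pos.le t)
    (le_min zero_le_one (by positivity)))

/-- The mixing constant never exceeds the effective horizon `1 / (1 - γ)`. -/
lemma one_add_mixSum_le (hC : 0 < C) (hβ0 : 0 < β) : (1 - M.gam) * (1 + M.mixSum C β) ≤ 1 := by
  have h : ∑' t : ℕ, M.gam ^ t * min 1 (2 * C * β ^ t) ≤ (1 - M.gam)⁻¹ := by
    rw [← tsum_geometric_of_lt_one M.gam_pos.le M.gam_lt_one]
    refine Summable.tsum_le_tsum (fun t => ?_) (M.summable_discount (abs_min_le hC hβ0))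
      M.summable_geom
    exact mul_le_of_le_one_right (pow_nonneg M.gam_pos.le t) (min_le_left _ _)
  have h1 : 1 + M.mixSum C β ≤ (1 - M.gam)⁻¹ := by
    rw [mixSum]
    have := mul_le_mul_of_nonneg_left h M.gam_pos.le
    have e : 1 + M.gam * (1 - M.gam)⁻¹ = (1 - M.gam)⁻¹ := by
      have := M.one_sub_gam_pos.ne'
      field_simp; ring
    linarith
  have := mul_le_mul_of_nonneg_left h1 M.one_sub_gam_pos.le
  rwa [mul_inv_cancel₀ M.one_sub_gam_pos.ne'] at this

lemma mixSum_le_of_pow_le (hC : 0 < C) (hβ0 : 0 < β) (hβ1 : β < 1) (n : ℕ) (hn : C * β ^ n ≤ 1) :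
    M.mixSum C β ≤ n + 2 / (1 - β) := by
  have hs : Summable fun t : ℕ => M.gam ^ t * min 1 (2 * C * β ^ t) :=
    M.summable_discount (abs_min_le hC hβ0)
  have hg : ∀ t, M.gam ^ t ≤ 1 := fun t => pow_le_one₀ M.gam_pos.le M.gam_lt_one.le
  have hk : ∀ t, 0 ≤ min 1 (2 * C * β ^ t) := fun t => le_min zero_le_one (by positivity)
  have h1 : ∑' t : ℕ, M.gam ^ t * min 1 (2 * C * β ^ t) ≤ n + 2 / (1 - β) := by
    rw [← hs.sum_add_tsum_nat_add n]
    refine add_le_add ?_ ?_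
    · refine (Finset.sum_le_card_nsmul _ _ 1 fun t _ => ?_).trans (by simp)
      exact mul_le_one₀ (hg t) (hk t) (min_le_left _ _)
    · rw [div_eq_mul_inv, ← tsum_geometric_of_lt_one hβ0.le hβ1, ← tsum_mul_left]
      refine Summable.tsum_le_tsum (fun t => ?_) ((summable_nat_add_iff n).2 hs)
        ((summable_geometric_of_lt_one hβ0.le hβ1).mul_left _)
      refine (mul_le_of_le_one_left (hk _) (hg _)).trans ((min_le_right _ _).trans ?_)
      have := mul_le_mul_of_nonneg_right hn (pow_nonneg hβ0.le t)
      rw [pow_add]; linarith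
  have h0 : 0 ≤ ∑' t : ℕ, M.gam ^ t * min 1 (2 * C * β ^ t) :=
    tsum_nonneg fun t => mul_nonneg (pow_nonneg M.gam_pos.le t) (hk t)
  exact (mul_le_of_le_one_left h0 M.gam_lt_one.le).trans h1

lemma mixSum_le_geom (hC : 0 < C) (hβ0 : 0 < β) (hβ1 : β < 1) :
    M.mixSum C β ≤ 2 * C / (1 - β) := by
  have hk : ∀ t, 0 ≤ min 1 (2 * C * β ^ t) := fun t => le_min zero_le_one (by positivity)
  have h0 : 0 ≤ ∑' t : ℕ, M.gam ^ t * min 1 (2 * C * β ^ t) :=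
    tsum_nonneg fun t => mul_nonneg (pow_nonneg M.gam_pos.le t) (hk t)
  refine (mul_le_of_le_one_left h0 M.gam_lt_one.le).trans ?_
  rw [div_eq_mul_inv, ← tsum_geometric_of_lt_one hβ0.le hβ1, ← tsum_mul_left]
  refine Summable.tsum_le_tsum (fun t => ?_) (M.summable_discount (abs_min_le hC hβ0))
    ((summable_geometric_of_lt_one hβ0.le hβ1).mul_left _)
  exact (mul_le_of_le_one_left (hk _) (pow_le_one₀ M.gam_pos.le M.gam_lt_one.le)).trans
    (min_le_right _ _)

/-- The mixing constant is controlled by `ergConst`. For `C < 1` the logarithm in `ergConst` is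
negative, and the lower bound `1 / 2 ≤ C` is needed. -/
lemma one_add_mixSum_le_ergConst (hC : 1 / 2 ≤ C) (hβ0 : 0 < β) (hβ1 : β < 1) :
    1 + M.mixSum C β ≤ 4 * ergConst C β := by
  have hC0 : 0 < C := by linarith
  have hb : 0 < 1 - β := sub_pos.2 hβ1
  have hlogβ : Real.log β < 0 := Real.log_neg hβ0 hβ1
  have hceil := Int.le_ceil (Real.logb β C⁻¹)
  rw [ergConst]
  set n := ⌈Real.logb β C⁻¹⌉ with hn
  rcases le_or_gt 0 n with h0 | h0
  · obtain ⟨k, hk⟩ := Int.eq_ofNat_of_zero_le h0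
    have hnk : (n : ℝ) = k := by rw [hk]; simp
    have h1 : C * β ^ k ≤ 1 := by
      have h2 : Real.logb β C⁻¹ ≤ k := by rw [← hnk]; exact hceil
      rw [Real.logb_le_iff_le_rpow_of_base_lt_one hβ0 hβ1 (inv_pos.2 hC0),
        Real.rpow_natCast] at h2
      have := mul_le_mul_of_nonneg_left h2 hC0.le
      rwa [mul_inv_cancel₀ hC0.ne'] at this
    have h3 := M.mixSum_le_of_pow_le hC0 hβ0 hβ1 k h1
    rw [hnk]
    have h4 : 0 < (1 - β)⁻¹ := inv_pos.2 hb
    rw [div_eq_mul_inv] at h3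
    have : (0 : ℝ) ≤ k := Nat.cast_nonneg k
    linarith
  · have h1 : Real.logb β C⁻¹ < 0 := hceil.trans_lt (by exact_mod_cast h0)
    have hC1 : C < 1 := by
      by_contra hge
      have := Real.logb_nonneg_of_base_lt_one hβ0 hβ1 (inv_pos.2 hC0) (inv_le_one_of_one_le₀ (not_lt.1 hge))
      linarith
    have hlogC : Real.log C < 0 := Real.log_neg hC0 hC1
    have h2 : Real.log C / (1 - β) ≤ n := by
      refine le_trans ?_ hceil
      rw [Real.logb, Real.log_inv, neg_div, ← div_neg, div_le_div_iff₀ hb (by linarith)]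
      nlinarith [Real.log_le_sub_one_of_pos hβ0]
    have h3 := M.mixSum_le_geom hC0 hβ0 hβ1
    have h4 : C ≤ 2 * (1 + Real.log C) := by
      have h5 := Real.one_sub_inv_le_log_of_pos (show 0 < 2 * C by linarith)
      rw [Real.log_mul (by norm_num) hC0.ne', mul_inv] at h5
      have h6 := Real.log_two_lt_d9
      have h7 : C⁻¹ ≤ 5 / 2 - C := by
        rw [inv_le_iff_one_le_mul₀ hC0]; nlinarith
      linarith
    have h8 : 2 * C / (1 - β) ≤ 4 * (n + (1 - β)⁻¹) := by
      have h9 : 2 * C / (1 - β) ≤ 4 * (Real.log C / (1 - β) + (1 - β)⁻¹) := by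
        rw [← one_div, ← add_div, mul_div_assoc', div_le_div_iff_of_pos_right hb]
        linarith
      linarith
    linarith

end mixSum

/-- In a space with at least two states, the ergodicity bound at time zero forces `1 / 2 ≤ C`. -/
lemma half_le_of_uniformlyErgodic [DecidableEq S] (M : CMDP S A m) {π : Policy S A} {C β : ℝ}
    (h : M.UniformlyErgodic π C β) (h1 : Fintype.card S = 1 → 1 / 2 ≤ C) : 1 / 2 ≤ C := by
  obtain ⟨χ, -, hχ⟩ := h
  have hne := M.nonempty_state
  by_cases hcard : Fintype.card S = 1
  · exact h1 hcard
  have : 1 < Fintype.card S := by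
    have := Fintype.card_pos (α := S)
    omega
  obtain ⟨x, y, hxy⟩ := Fintype.exists_pair_of_one_lt_card this
  have hx := hχ 0 x
  have hy := hχ 0 y
  rw [pow_zero, mul_one, stateDist] at hx hy
  have h2 := dTV_triangle (Pi.single x (1 : ℝ)) χ (Pi.single y 1)
  have h3 : 1 ≤ dTV (Pi.single x (1 : ℝ)) (Pi.single y 1) := by
    have : ∑ s ∈ {x, y}, |(Pi.single x (1 : ℝ) : S → ℝ) s - (Pi.single y 1 : S → ℝ) s|
        ≤ ∑ s, |(Pi.single x (1 : ℝ) : S → ℝ) s - (Pi.single y 1 : S → ℝ) s| :=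
      Finset.sum_le_sum_of_subset_of_nonneg (Finset.subset_univ _) fun _ _ _ => abs_nonneg _
    rw [Finset.sum_pair hxy] at this
    simp only [Pi.single_eq_same, Pi.single_eq_of_ne hxy, Pi.single_eq_of_ne hxy.symm] at this
    norm_num at this
    rw [dTV]; linarith
  linarith

/-- Under uniform ergodicity of the reference policy, values of rewards in `[0, R]` are Lipschitz
in the expected `ℓ¹` distance of the policies, with the mixing constant in place of an effective
horizon. -/
lemma abs_discounted_sub_le [DecidableEq S] (M : CMDP S A m) {C β : ℝ} (hC : 0 < C) (hβ0 : 0 < β)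
    (π πs : Policy S A) (herg : M.UniformlyErgodic πs C β) (f : S → A → ℝ) {R : ℝ}
    (hf0 : ∀ s a, 0 ≤ f s a) (hf1 : ∀ s a, f s a ≤ R) :
    (1 - M.gam) * |M.discounted π f - M.discounted πs f|
      ≤ R * (1 + M.mixSum C β) / 2 * ∑ s, M.stateVisit π s * ∑ a, |π.1 s a - πs.1 s a| := by
  obtain ⟨χ, -, hχ⟩ := herg
  have hne := M.nonempty_state
  have hR : 0 ≤ R := by
    obtain ⟨s⟩ := hne
    obtain ⟨a⟩ := M.nonempty_action πs
    exact (hf0 s a).trans (hf1 s a)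
  -- the one-step reward under `πs`
  set g : S → ℝ := fun x => ∑ a, πs.1 x a * f x a with hg
  have hg0 : ∀ x, 0 ≤ g x := fun x =>
    Finset.sum_nonneg fun a _ => mul_nonneg ((πs.2 x).1 a) (hf0 x a)
  have hg1 : ∀ x, g x ≤ 0 + R := fun x => by
    refine (Finset.sum_le_sum fun a _ => mul_le_mul_of_nonneg_left (hf1 x a) ((πs.2 x).1 a)).trans ?_
    rw [← Finset.sum_mul, (πs.2 x).2, one_mul, zero_add]
  have hosc : ∀ s s', M.gam * M.stateValue πs f s
      ≤ M.gam * M.stateValue πs f s' + R * M.mixSum C β := by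
    intro s s'
    have h1 : M.stateValue πs f s - M.stateValue πs f s'
        ≤ R * ∑' t : ℕ, M.gam ^ t * min 1 (2 * C * β ^ t) := by
      rw [stateValue, stateValue, ← (M.summable_stateValue πs f s).tsum_sub
        (M.summable_stateValue πs f s'), ← tsum_mul_left]
      refine Summable.tsum_le_tsum (fun t => ?_)
        ((M.summable_stateValue πs f s).sub (M.summable_stateValue πs f s'))
        ((M.summable_discount (abs_min_le hC hβ0)).mul_left _)
      rw [← mul_sub, mul_left_comm]
      refine mul_le_mul_of_nonneg_left ?_ (pow_nonneg M.gam_pos.le t)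
      have hp := M.stateDist_mem πs (single_mem s) t
      have hp' := M.stateDist_mem πs (single_mem s') t
      rw [← Finset.sum_sub_distrib]
      simp_rw [← sub_mul]
      refine (le_abs_self _).trans ((abs_sum_mul_le_of_sum_eq_zero
        (by rw [Finset.sum_sub_distrib, hp.2, hp'.2, sub_self]) hg0 hg1).trans ?_)
      have e1 := dTV_le_one hp hp'
      have e2 : dTV (M.stateDist πs (Pi.single s 1) t) (M.stateDist πs (Pi.single s' 1) t)
          ≤ 2 * C * β ^ t := by
        linarith [dTV_triangle (M.stateDist πs (Pi.single s 1) t) χ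
          (M.stateDist πs (Pi.single s' 1) t), hχ t s, hχ t s']
      have e3 := mul_le_mul_of_nonneg_left (le_min e1 e2) hR
      rw [dTV] at e3
      linarith
    have := mul_le_mul_of_nonneg_left h1 M.gam_pos.le
    rw [mixSum]
    linarith
  -- the action values oscillate by at most `R * (1 + mixSum)` above the least state value
  obtain ⟨s₀, hs₀⟩ := Finite.exists_min (M.stateValue πs f)
  have hQ0 : ∀ s a, M.gam * M.stateValue πs f s₀ ≤ M.actionValue πs f s a := by
    intro s a
    have h1 : M.stateValue πs f s₀ ≤ ∑ s', M.P s a s' * M.stateValue πs f s' := by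
      calc M.stateValue πs f s₀ = ∑ s', M.P s a s' * M.stateValue πs f s₀ := by
            rw [← Finset.sum_mul, (M.P_mem s a).2, one_mul]
        _ ≤ _ := Finset.sum_le_sum fun s' _ =>
          mul_le_mul_of_nonneg_left (hs₀ s') ((M.P_mem s a).1 s')
    have := mul_le_mul_of_nonneg_left h1 M.gam_pos.le
    rw [actionValue]
    linarith [hf0 s a]
  have hQ1 : ∀ s a, M.actionValue πs f s a
      ≤ M.gam * M.stateValue πs f s₀ + R * (1 + M.mixSum C β) := by
    intro s a
    have h1 : M.gam * ∑ s', M.P s a s' * M.stateValue πs f s'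
        ≤ M.gam * M.stateValue πs f s₀ + R * M.mixSum C β := by
      calc _ = ∑ s', M.P s a s' * (M.gam * M.stateValue πs f s') := by
            rw [Finset.mul_sum]; exact Finset.sum_congr rfl fun _ _ => by ring
        _ ≤ ∑ s', M.P s a s' * (M.gam * M.stateValue πs f s₀ + R * M.mixSum C β) :=
            Finset.sum_le_sum fun s' _ =>
              mul_le_mul_of_nonneg_left (hosc s' s₀) ((M.P_mem s a).1 s')
        _ = _ := by rw [← Finset.sum_mul, (M.P_mem s a).2, one_mul]
    rw [actionValue]
    linarith [hf1 s a]
  have e : (1 - M.gam) * |M.discounted π f - M.discounted πs f|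
      = |(1 - M.gam) * (M.discounted π f - M.discounted πs f)| := by
    rw [abs_mul, abs_of_pos M.one_sub_gam_pos]
  rw [e, discounted_sub, Finset.mul_sum]
  refine (Finset.abs_sum_le_sum_abs _ _).trans (Finset.sum_le_sum fun s _ => ?_)
  rw [abs_mul, abs_of_nonneg (M.stateVisit_nonneg π s), mul_left_comm]
  exact mul_le_mul_of_nonneg_left (abs_sum_mul_le_of_sum_eq_zero
    (by rw [Finset.sum_sub_distrib, (π.2 s).2, (πs.2 s).2, sub_self]) (hQ0 s) (hQ1 s))
    (M.stateVisit_nonneg π s)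

end CMDP

/-! ### One step of accelerated proximal descent -/

section Accelerated

variable {E : Type*} [NormedAddCommGroup E] [InnerProductSpace ℝ E]

/-- The three-point inequality for a proximal step: the minimized function is strongly convex. -/
lemma prox_three_point {K : Set E} (hK : Convex ℝ K) {η μ : ℝ} {g y z z' : E} (hz' : z' ∈ K)
    (hmin : IsMinOn (fun x => η * (inner ℝ g x + μ / 2 * ‖x - y‖ ^ 2) + 1 / 2 * ‖x - z‖ ^ 2) K z')
    {l : E} (hl : l ∈ K) :
    η * inner ℝ g (z' - l) + η * μ / 2 * ‖z' - y‖ ^ 2 + 1 / 2 * ‖z' - z‖ ^ 2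
        + (η * μ + 1) / 2 * ‖l - z'‖ ^ 2
      ≤ η * μ / 2 * ‖l - y‖ ^ 2 + 1 / 2 * ‖l - z‖ ^ 2 := by
  set d := l - z' with hd
  set D := η * inner ℝ g d + η * μ * inner ℝ (z' - y) d + inner ℝ (z' - z) d with hD
  set c := (η * μ + 1) / 2 * ‖d‖ ^ 2 with hc
  have expand : ∀ (s : ℝ) (w : E), ‖z' + s • d - w‖ ^ 2
      = ‖z' - w‖ ^ 2 + 2 * s * inner ℝ (z' - w) d + s ^ 2 * ‖d‖ ^ 2 := by
    intro s w
    rw [show z' + s • d - w = (z' - w) + s • d by abel, norm_add_sq_real, inner_smul_right,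
      norm_smul, mul_pow, Real.norm_eq_abs, sq_abs]
    ring
  -- `D` is the derivative of the objective at `z'` in the direction `d`, hence nonnegative
  have h1 : ∀ s ∈ Set.Ioo (0 : ℝ) 1, 0 ≤ D + s * c := by
    intro s hs
    have hmem : z' + s • d ∈ K := hK.add_smul_sub_mem hz' hl ⟨hs.1.le, hs.2.le⟩
    have := hmin hmem
    simp only [Set.mem_ofPred_eq, expand, inner_add_right, inner_smul_right] at this
    refine le_of_mul_le_mul_left ?_ hs.1
    rw [hD, hc]
    nlinarith
  have h2 : 0 ≤ D := by
    have ht : Filter.Tendsto (fun s : ℝ => D + s * c) (nhdsWithin 0 (Set.Ioi 0)) (nhds D) := by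
      have : ContinuousAt (fun s : ℝ => D + s * c) 0 := by fun_prop
      simpa using this.tendsto.mono_left nhdsWithin_le_nhds
    exact ge_of_tendsto ht (Filter.Eventually.mono (Ioo_mem_nhdsGT one_pos) h1)
  have ey := expand 1 y
  have ez := expand 1 z
  rw [one_smul, hd, add_sub_cancel, ← hd] at ey ez
  rw [ey, ez, show z' - l = -d by rw [hd]; abel, inner_neg_right]
  rw [hD] at h2
  nlinarith

/-- Decrease of the potential `φ x + μ / 2 * ‖l - z‖ ^ 2` in one accelerated step, for a
`μ`-strongly convex `L`-smooth `φ`, in terms of the quadratic model built from the inexact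
gradient `g'` at the search point `y`. -/
lemma accelerated_step {φ : E → ℝ} {K : Set E} (hK : Convex ℝ K) {L μ α η : ℝ} (hμ : 0 < μ)
    (hα0 : 0 < α) (hα1 : α < 1) (hL : L * α ^ 2 = μ / 2) (hη : η = α / (μ * (1 - α)))
    {g g' x y z x' z' l : E} (hy : (1 + α) • y = x + α • z) (hx' : x' = (1 - α) • x + α • z')
    (hz' : z' ∈ K) (hl : l ∈ K)
    (hmin : IsMinOn (fun x => η * (inner ℝ g' x + μ / 2 * ‖x - y‖ ^ 2) + 1 / 2 * ‖x - z‖ ^ 2) K z')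
    (hup : φ x' ≤ φ y + inner ℝ g (x' - y) + L / 2 * ‖x' - y‖ ^ 2)
    (hlow : φ y + inner ℝ g (x - y) ≤ φ x) :
    φ x' + μ / 2 * ‖l - z'‖ ^ 2 ≤ (1 - α) * (φ x + μ / 2 * ‖l - z‖ ^ 2)
      + α * (φ y + inner ℝ g' (l - y) + μ / 2 * ‖l - y‖ ^ 2)
      + α * (‖g' - g‖ * ‖z' - y‖) := by
  have hβ : 0 < 1 - α := sub_pos.2 hα1
  have hprox := prox_three_point hK hz' hmin hl
  have hημ : η * (μ * (1 - α)) = α := by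
    rw [hη, div_mul_cancel₀ _ (mul_pos hμ hβ).ne']
  have hprox' : α * inner ℝ g' (z' - l) + α * μ / 2 * ‖z' - y‖ ^ 2
      + μ * (1 - α) / 2 * ‖z' - z‖ ^ 2 + μ / 2 * ‖l - z'‖ ^ 2
      ≤ α * μ / 2 * ‖l - y‖ ^ 2 + μ * (1 - α) / 2 * ‖l - z‖ ^ 2 := by
    have h := mul_le_mul_of_nonneg_left hprox (mul_pos hμ hβ).le
    have e1 : ∀ a b c d : ℝ, μ * (1 - α) * (η * a + η * μ / 2 * b + 1 / 2 * c + (η * μ + 1) / 2 * d)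
        = (η * (μ * (1 - α))) * a + (η * (μ * (1 - α))) * μ / 2 * b + μ * (1 - α) / 2 * c
          + ((η * (μ * (1 - α))) * μ + μ * (1 - α)) / 2 * d := by intros; ring
    have e2 : ∀ b c : ℝ, μ * (1 - α) * (η * μ / 2 * b + 1 / 2 * c)
        = (η * (μ * (1 - α))) * μ / 2 * b + μ * (1 - α) / 2 * c := by intros; ring
    rw [e1, e2, hημ] at h
    linarith
  have hxy : x - y = -(α • (z - y)) := by
    have : x = (1 + α) • y - α • z := by rw [hy]; abel
    rw [this]; module
  have hx'y : x' - y = α • ((z' - y) - (1 - α) • (z - y)) := by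
    rw [hx', eq_add_of_sub_eq hxy]; module
  have hzz : z' - z = (z' - y) - (z - y) := by abel
  have hsplit : inner ℝ g (x' - y) = (1 - α) * inner ℝ g (x - y) + α * inner ℝ g (z' - y) := by
    rw [← inner_smul_right, ← inner_smul_right, ← inner_add_right, hx']
    congr 1; module
  have hquad : L / 2 * ‖x' - y‖ ^ 2
      ≤ μ / 4 * ((1 - α) * ‖z' - z‖ ^ 2 + α * ‖z' - y‖ ^ 2) := by
    rw [hx'y, norm_smul, mul_pow, Real.norm_eq_abs, sq_abs, ← mul_assoc,
      show L / 2 * α ^ 2 = μ / 4 by linarith, hzz,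
      norm_sub_sq_real (z' - y) ((1 - α) • (z - y)), norm_sub_sq_real (z' - y) (z - y),
      norm_smul, inner_smul_right, mul_pow, Real.norm_eq_abs, sq_abs]
    refine mul_le_mul_of_nonneg_left ?_ (by positivity)
    nlinarith [mul_nonneg (mul_pos hα0 hβ).le (sq_nonneg ‖z - y‖)]
  have herr : inner ℝ g (z' - y) ≤ inner ℝ g' (z' - y) + ‖g' - g‖ * ‖z' - y‖ := by
    have := abs_le.1 (abs_real_inner_le_norm (g' - g) (z' - y))
    rw [inner_sub_left] at this
    linarith [this.1]
  have hdec : inner ℝ g' (z' - y) = inner ℝ g' (z' - l) + inner ℝ g' (l - y) := by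
    rw [← inner_add_right]; congr 1; abel
  rw [hsplit] at hup
  have h1 := mul_le_mul_of_nonneg_left hlow hβ.le
  have h2 := mul_le_mul_of_nonneg_left herr hα0.le
  rw [hdec] at h2
  have h3 : 0 ≤ μ * (1 - α) * ‖z' - z‖ ^ 2 := by positivity
  have h4 : 0 ≤ μ * α * ‖z' - y‖ ^ 2 := by positivity
  linarith

end Accelerated

namespace CMDP

variable {S A : Type*} [Fintype S] [Fintype A] {m : ℕ}

/-! ### Bounds on values and entropies -/

lemma le_rmax (M : CMDP S A m) (i : Fin (m + 1)) (s : S) (a : A) : M.r i s a ≤ M.rmax i :=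
  le_ciSup (f := fun x : S × A => M.r i x.1 x.2) (Set.finite_range _).bddAbove (s, a)

lemma rmax_nonneg (M : CMDP S A m) (i : Fin (m + 1)) : 0 ≤ M.rmax i :=
  Real.iSup_nonneg fun x => (M.r_pos i x.1 x.2).le

lemma rmax_pos (M : CMDP S A m) (π : Policy S A) (i : Fin (m + 1)) : 0 < M.rmax i := by
  obtain ⟨s⟩ := M.nonempty_state
  obtain ⟨a⟩ := M.nonempty_action π
  exact (M.r_pos i s a).trans_le (M.le_rmax i s a)

lemma sum_visit (M : CMDP S A m) (π : Policy S A) : ∑ s, ∑ a, M.visit π s a = 1 :=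
  M.sum_stateVisit π

lemma V_nonneg (M : CMDP S A m) (i : Fin (m + 1)) (π : Policy S A) : 0 ≤ M.V i π := by
  rw [V, discounted_eq_div]
  exact div_nonneg (Finset.sum_nonneg fun s _ => Finset.sum_nonneg fun a _ =>
    mul_nonneg (M.visit_nonneg π s a) (M.r_pos i s a).le) M.one_sub_gam_pos.le

lemma V_le (M : CMDP S A m) (i : Fin (m + 1)) (π : Policy S A) :
    M.V i π ≤ M.rmax i / (1 - M.gam) := by
  rw [V, discounted_eq_div]
  refine div_le_div_of_nonneg_right ?_ M.one_sub_gam_pos.le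
  calc _ ≤ ∑ s, ∑ a, M.visit π s a * M.rmax i :=
        Finset.sum_le_sum fun s _ => Finset.sum_le_sum fun a _ =>
          mul_le_mul_of_nonneg_left (M.le_rmax i s a) (M.visit_nonneg π s a)
    _ = M.rmax i := by simp_rw [← Finset.sum_mul]; rw [sum_visit, one_mul]

lemma entropy_nonneg (M : CMDP S A m) (π : Policy S A) : 0 ≤ M.entropy π := by
  rw [entropy, discounted_eq_div]
  exact div_nonneg (Finset.sum_nonneg fun s _ => Finset.sum_nonneg fun a _ =>
    mul_nonneg (M.visit_nonneg π s a) (neg_nonneg.2 (Real.log_nonpos ((π.2 s).1 a)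
      (le_one_of_mem (π.2 s) a)))) M.one_sub_gam_pos.le

/-- The discounted entropy is at most that of the uniform policy, by nonnegativity of the relative
entropy. -/
lemma entropy_le (M : CMDP S A m) (π : Policy S A) :
    M.entropy π ≤ Real.log (Fintype.card A) / (1 - M.gam) := by
  have := M.nonempty_action π
  have hcard : (0 : ℝ) < Fintype.card A := by exact_mod_cast Fintype.card_pos
  rw [entropy, discounted_eq_div]
  refine div_le_div_of_nonneg_right ?_ M.one_sub_gam_pos.le
  have h1 : ∀ s, ∑ a, π.1 s a * -Real.log (π.1 s a) ≤ Real.log (Fintype.card A) := by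
    intro s
    have hq : (fun _ : A => (Fintype.card A : ℝ)⁻¹) ∈ stdSimplex ℝ A :=
      ⟨fun _ => by positivity, by simp [hcard.ne']⟩
    have h := sq_sum_abs_sub_le_kl (π.2 s) hq fun a ha => absurd ha (inv_pos.2 hcard).ne'
    simp_rw [mul_sub, Finset.sum_sub_distrib, ← Finset.sum_mul, (π.2 s).2, Real.log_inv] at h
    simp_rw [mul_neg, Finset.sum_neg_distrib]
    have : 0 ≤ (∑ a, |π.1 s a - (Fintype.card A : ℝ)⁻¹|) ^ 2 / 4 := by positivity
    linarith
  calc _ = ∑ s, M.stateVisit π s * ∑ a, π.1 s a * -Real.log (π.1 s a) := by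
        simp_rw [visit_eq, mul_assoc, ← Finset.mul_sum]
    _ ≤ ∑ s, M.stateVisit π s * Real.log (Fintype.card A) := Finset.sum_le_sum fun s _ =>
        mul_le_mul_of_nonneg_left (h1 s) (M.stateVisit_nonneg π s)
    _ = _ := by rw [← Finset.sum_mul, sum_stateVisit, one_mul]

lemma norm_le_Rmax (M : CMDP S A m) {k : ℝ} (hk : 0 ≤ k) (v : EuclideanSpace ℝ (Fin m))
    (hv : ∀ i, |v i| ≤ k * M.rmax i.succ) : ‖v‖ ≤ k * M.Rmax := by
  have e : k * M.Rmax = √(k ^ 2 * ∑ i : Fin m, M.rmax i.succ ^ 2) := by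
    rw [Real.sqrt_mul (sq_nonneg k), Real.sqrt_sq hk, Rmax]
  rw [EuclideanSpace.norm_eq, e, Finset.mul_sum]
  refine Real.sqrt_le_sqrt (Finset.sum_le_sum fun i _ => ?_)
  rw [Real.norm_eq_abs, ← mul_pow]
  exact pow_le_pow_left₀ (abs_nonneg _) (hv i) 2

lemma Rmax_nonneg (M : CMDP S A m) : 0 ≤ M.Rmax := Real.sqrt_nonneg _

lemma abs_V_sub_le (M : CMDP S A m) (i : Fin (m + 1)) (π π' : Policy S A) :
    |M.V i π - M.V i π'| ≤ M.rmax i / (1 - M.gam) :=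
  abs_le.2 ⟨by linarith [M.V_nonneg i π, M.V_le i π'], by linarith [M.V_nonneg i π', M.V_le i π]⟩

lemma norm_Vvec_sub_le (M : CMDP S A m) (π π' : Policy S A) :
    ‖M.Vvec π - M.Vvec π'‖ ≤ M.Rmax / (1 - M.gam) := by
  rw [div_eq_inv_mul]
  refine M.norm_le_Rmax (inv_nonneg.2 M.one_sub_gam_pos.le) _ fun i => ?_
  rw [← div_eq_inv_mul]
  exact M.abs_V_sub_le i.succ π π'

lemma norm_Vvec_le (M : CMDP S A m) (π : Policy S A) : ‖M.Vvec π‖ ≤ M.Rmax / (1 - M.gam) := by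
  rw [div_eq_inv_mul]
  refine M.norm_le_Rmax (inv_nonneg.2 M.one_sub_gam_pos.le) _ fun i => ?_
  rw [← div_eq_inv_mul]
  exact (abs_of_nonneg (M.V_nonneg i.succ π)).trans_le (M.V_le i.succ π)

/-! ### The regularized dual function -/

/-- The reward function `r₀ + ∑ᵢ lamᵢ rᵢ` of the Lagrangian. -/
noncomputable def lagrReward (M : CMDP S A m) (lam : EuclideanSpace ℝ (Fin m)) (s : S) (a : A) : ℝ :=
  M.r 0 s a + ∑ i : Fin m, lam i * M.r i.succ s a

lemma inner_eq_sum (x y : EuclideanSpace ℝ (Fin m)) : inner ℝ x y = ∑ i, x i * y i := by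
  rw [PiLp.inner_apply]
  exact Finset.sum_congr rfl fun i _ => by simp [mul_comm]

lemma lagr_eq (M : CMDP S A m) (π : Policy S A) (lam : EuclideanSpace ℝ (Fin m)) :
    M.lagr π lam = M.discounted π (M.lagrReward lam) - inner ℝ lam M.c := by
  have h : M.discounted π (M.lagrReward lam) = M.V 0 π + inner ℝ lam (M.Vvec π) := by
    rw [inner_eq_sum]
    simp only [V, Vvec, discounted_eq_div, lagrReward, mul_add, Finset.sum_add_distrib, add_div,
      mul_div_assoc', ← Finset.sum_div, Finset.mul_sum]
    congr 2
    simp_rw [mul_left_comm]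
    rw [eq_comm, Finset.sum_comm]
    refine Finset.sum_congr rfl fun s _ => ?_
    rw [Finset.sum_comm]
  rw [lagr, h, inner_sub_right]
  ring

lemma regLagr_eq (M : CMDP S A m) (τ μ : ℝ) (π : Policy S A) (lam : EuclideanSpace ℝ (Fin m)) :
    M.regLagr τ μ π lam
      = M.regValue τ (M.lagrReward lam) π - inner ℝ lam M.c + μ / 2 * ‖lam‖ ^ 2 := by
  rw [regLagr, lagr_eq, regValue]
  ring

/-- The regularized Lagrangian is quadratic in the multiplier. -/
lemma regLagr_shift (M : CMDP S A m) (τ μ : ℝ) (π : Policy S A)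
    (x y : EuclideanSpace ℝ (Fin m)) :
    M.regLagr τ μ π y = M.regLagr τ μ π x + inner ℝ (M.gradEst μ π x) (y - x)
      + μ / 2 * ‖y - x‖ ^ 2 := by
  obtain ⟨d, rfl⟩ : ∃ d, y = x + d := ⟨y - x, by abel⟩
  rw [regLagr, regLagr, lagr, lagr, gradEst, add_sub_cancel_left, norm_add_sq_real,
    inner_add_left, inner_add_left, real_inner_smul_left, real_inner_comm d x,
    real_inner_comm d (M.Vvec π - M.c)]
  ring

lemma bddAbove_regLagr (M : CMDP S A m) {τ : ℝ} (hτ : 0 < τ) (μ : ℝ)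
    (lam : EuclideanSpace ℝ (Fin m)) :
    BddAbove (Set.range fun π : Policy S A => M.regLagr τ μ π lam) := by
  refine ⟨M.rmax 0 / (1 - M.gam) + ‖lam‖ * (M.Rmax / (1 - M.gam) + ‖M.c‖)
    + τ * (Real.log (Fintype.card A) / (1 - M.gam)) + μ / 2 * ‖lam‖ ^ 2, ?_⟩
  rintro _ ⟨π, rfl⟩
  have h1 := (real_inner_le_norm lam (M.Vvec π - M.c)).trans (mul_le_mul_of_nonneg_left
    ((norm_sub_le _ _).trans (add_le_add_left (M.norm_Vvec_le π) _)) (norm_nonneg lam))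
  have h2 := mul_le_mul_of_nonneg_left (M.entropy_le π) hτ.le
  have h3 := M.V_le 0 π
  simp only [regLagr, lagr]
  linarith

lemma regLagr_le_dual (M : CMDP S A m) {τ : ℝ} (hτ : 0 < τ) (μ : ℝ)
    (lam : EuclideanSpace ℝ (Fin m)) (π : Policy S A) :
    M.regLagr τ μ π lam ≤ M.dual τ μ lam :=
  le_ciSup (M.bddAbove_regLagr hτ μ lam) π

lemma dual_eq (M : CMDP S A m) {τ : ℝ} (hτ : 0 < τ) {μ : ℝ} {lam : EuclideanSpace ℝ (Fin m)}
    {πs : Policy S A} (h : M.IsRegOptimal τ μ lam πs) : M.dual τ μ lam = M.regLagr τ μ πs lam :=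
  have : Nonempty (Policy S A) := ⟨πs⟩
  le_antisymm (ciSup_le h) (M.regLagr_le_dual hτ μ lam πs)

/-- The dual function is strongly convex, as a supremum of quadratics. -/
lemma dual_lower (M : CMDP S A m) {τ : ℝ} (hτ : 0 < τ) {μ : ℝ}
    {x : EuclideanSpace ℝ (Fin m)} {πs : Policy S A} (h : M.IsRegOptimal τ μ x πs)
    (y : EuclideanSpace ℝ (Fin m)) :
    M.dual τ μ x + inner ℝ (M.gradEst μ πs x) (y - x) + μ / 2 * ‖y - x‖ ^ 2 ≤ M.dual τ μ y := by
  rw [dual_eq M hτ h, ← regLagr_shift]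
  exact M.regLagr_le_dual hτ μ y πs

/-- The dual function is smooth at a multiplier whose optimal policy is uniformly ergodic: the
linear gain from moving the policy is dominated by the quadratic growth of the regularized
objective. -/
lemma dual_upper [DecidableEq S] (M : CMDP S A m) {τ : ℝ} (hτ : 0 < τ) {μ C β : ℝ}
    (hC : 1 / 2 ≤ C) (hβ0 : 0 < β) (hβ1 : β < 1)
    {x : EuclideanSpace ℝ (Fin m)} {πs : Policy S A} (h : M.IsRegOptimal τ μ x πs)
    (herg : M.UniformlyErgodic πs C β) (y : EuclideanSpace ℝ (Fin m)) :
    M.dual τ μ y ≤ M.dual τ μ x + inner ℝ (M.gradEst μ πs x) (y - x)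
      + (2 * M.Rmax ^ 2 * ergConst C β / ((1 - M.gam) ^ 2 * τ) + μ) / 2 * ‖y - x‖ ^ 2 := by
  have : Nonempty (Policy S A) := ⟨πs⟩
  have hg := M.one_sub_gam_pos
  have hC0 : 0 < C := by linarith
  refine ciSup_le fun π => ?_
  set K := 1 + M.mixSum C β with hK
  have hK0 : 0 < K := by linarith [M.mixSum_nonneg hC0 hβ0]
  have hK1 : (1 - M.gam) * K ≤ 1 := M.one_add_mixSum_le hC0 hβ0
  have hK2 : K ≤ 4 * ergConst C β := M.one_add_mixSum_le_ergConst hC hβ0 hβ1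
  set u := ∑ s, M.stateVisit π s * ∑ a, |π.1 s a - πs.1 s a| with hu
  have hu0 : 0 ≤ u := Finset.sum_nonneg fun s _ =>
    mul_nonneg (M.stateVisit_nonneg π s) (Finset.sum_nonneg fun _ _ => abs_nonneg _)
  set d := ‖y - x‖ with hd
  have hV : ‖M.Vvec π - M.Vvec πs‖ ≤ K * u / (2 * (1 - M.gam)) * M.Rmax := by
    refine M.norm_le_Rmax (by positivity) _ fun i => ?_
    have := M.abs_discounted_sub_le hC0 hβ0 π πs herg (M.r i.succ)
      (fun s a => (M.r_pos i.succ s a).le) (M.le_rmax i.succ)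
    rw [← hK, ← hu] at this
    rw [div_mul_eq_mul_div, le_div_iff₀ (by positivity)]
    change |M.discounted π (M.r i.succ) - M.discounted πs (M.r i.succ)| * _ ≤ _
    linarith
  have hgrow := M.regValue_growth hτ (M.lagrReward x) πs π fun π' => by
    have := h π'
    rw [regLagr_eq, regLagr_eq] at this
    linarith
  have hgap : τ / (4 * (1 - M.gam)) * u ^ 2 ≤ M.regLagr τ μ πs x - M.regLagr τ μ π x := by
    rw [regLagr_eq, regLagr_eq, ← div_div, div_mul_eq_mul_div, div_le_iff₀ hg]
    linarith
  have hlin : inner ℝ (M.gradEst μ π x) (y - x) ≤ inner ℝ (M.gradEst μ πs x) (y - x)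
      + K * u / (2 * (1 - M.gam)) * M.Rmax * d := by
    have h1 : M.gradEst μ π x = M.gradEst μ πs x + (M.Vvec π - M.Vvec πs) := by
      simp only [gradEst]; abel
    rw [h1, inner_add_left]
    linarith [(real_inner_le_norm (M.Vvec π - M.Vvec πs) (y - x)).trans
      (mul_le_mul_of_nonneg_right hV (norm_nonneg _))]
  -- Young's inequality, with `(1 - γ) K ≤ 1` trading one mixing constant for the horizon
  have hyoung : K * u / (2 * (1 - M.gam)) * M.Rmax * d - τ / (4 * (1 - M.gam)) * u ^ 2
      ≤ M.Rmax ^ 2 * ergConst C β / ((1 - M.gam) ^ 2 * τ) * d ^ 2 := by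
    have h1 : K * u / (2 * (1 - M.gam)) * M.Rmax * d - τ / (4 * (1 - M.gam)) * u ^ 2
        = (K ^ 2 * M.Rmax ^ 2 * d ^ 2 - (τ * u - K * M.Rmax * d) ^ 2)
          / (4 * (1 - M.gam) * τ) := by
      field_simp; ring
    have h2 : (1 - M.gam) * K ^ 2 ≤ 4 * ergConst C β := by nlinarith
    rw [h1, div_mul_eq_mul_div, div_le_div_iff₀ (by positivity) (by positivity)]
    have h3 : 0 ≤ M.Rmax ^ 2 * d ^ 2 * ((1 - M.gam) * τ) := by positivity
    have h4 := mul_le_mul_of_nonneg_left h2 h3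
    have h5 : 0 ≤ (τ * u - K * M.Rmax * d) ^ 2 * ((1 - M.gam) ^ 2 * τ) := by positivity
    linarith
  rw [regLagr_shift M τ μ π x y, dual_eq M hτ h, ← hd]
  have e : (2 * M.Rmax ^ 2 * ergConst C β / ((1 - M.gam) ^ 2 * τ) + μ) / 2 * d ^ 2
      = M.Rmax ^ 2 * ergConst C β / ((1 - M.gam) ^ 2 * τ) * d ^ 2 + μ / 2 * d ^ 2 := by ring
  rw [e]
  linarith

/-- Danskin's formula for the gradient of the dual function. -/
lemma gradient_dual [DecidableEq S] (M : CMDP S A m) {τ : ℝ} (hτ : 0 < τ) {μ C β : ℝ}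
    (hμ : 0 < μ) (hC : 1 / 2 ≤ C) (hβ0 : 0 < β) (hβ1 : β < 1)
    {x : EuclideanSpace ℝ (Fin m)} {πs : Policy S A} (h : M.IsRegOptimal τ μ x πs)
    (herg : M.UniformlyErgodic πs C β) :
    gradient (M.dual τ μ) x = M.gradEst μ πs x := by
  refine HasGradientAt.gradient (hasGradientAt_iff_isLittleO.2 ?_)
  set L := (2 * M.Rmax ^ 2 * ergConst C β / ((1 - M.gam) ^ 2 * τ) + μ) / 2 with hL
  have hO : (fun y => M.dual τ μ y - M.dual τ μ x - inner ℝ (M.gradEst μ πs x) (y - x))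
      =O[nhds x] fun y => ‖y - x‖ ^ 2 := by
    refine Asymptotics.IsBigO.of_bound L (Filter.Eventually.of_forall fun y => ?_)
    have h1 := M.dual_upper hτ hC hβ0 hβ1 h herg y
    rw [← hL] at h1
    have h2 := M.dual_lower hτ h y
    have h3 : 0 ≤ μ / 2 * ‖y - x‖ ^ 2 := by positivity
    rw [Real.norm_eq_abs, Real.norm_eq_abs, abs_of_nonneg (by linarith),
      abs_of_nonneg (sq_nonneg _)]
    linarith
  refine hO.trans_isLittleO (Asymptotics.isLittleO_norm_right.1 ?_)
  have ht : Filter.Tendsto (fun y => ‖y - x‖) (nhds x) (nhds 0) := by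
    have : ContinuousAt (fun y => ‖y - x‖) x := by fun_prop
    simpa using this.tendsto
  refine (Asymptotics.isLittleO_of_tendsto (fun y hy => by simp [hy]) ?_)
  refine ht.congr fun y => ?_
  by_cases h0 : ‖y - x‖ = 0
  · simp [h0]
  · field_simp

end CMDP

/-! ### Geometric weights -/

lemma le_of_geometric_recursion {p X : ℕ → ℝ} {α : ℝ} (hα1 : α ≤ 1) {T : ℕ}
    (h : ∀ t < T, p (t + 1) ≤ (1 - α) * p t + α * X (t + 1)) :
    ∀ t ≤ T, p t ≤ (1 - α) ^ t * p 0 + ∑ k ∈ Finset.Icc 1 t, α * (1 - α) ^ (t - k) * X k := by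
  intro t
  induction t with
  | zero => simp
  | succ t ih =>
    intro ht
    have h1 := mul_le_mul_of_nonneg_left (ih (by omega)) (sub_nonneg.2 hα1)
    have h2 : ∑ k ∈ Finset.Icc 1 t, α * (1 - α) ^ (t + 1 - k) * X k
        = (1 - α) * ∑ k ∈ Finset.Icc 1 t, α * (1 - α) ^ (t - k) * X k := by
      rw [Finset.mul_sum]
      refine Finset.sum_congr rfl fun k hk => ?_
      rw [Nat.sub_add_comm (Finset.mem_Icc.1 hk).2, pow_succ]; ring
    rw [Finset.sum_Icc_succ_top (by omega), h2, Nat.sub_self, pow_zero, mul_one, pow_succ]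
    linarith [h t (by omega)]

lemma sum_geometric_weights (α : ℝ) (t : ℕ) :
    ∑ k ∈ Finset.Icc 1 t, α * (1 - α) ^ (t - k) = 1 - (1 - α) ^ t := by
  induction t with
  | zero => simp
  | succ t ih =>
    have h2 : ∑ k ∈ Finset.Icc 1 t, α * (1 - α) ^ (t + 1 - k)
        = (1 - α) * ∑ k ∈ Finset.Icc 1 t, α * (1 - α) ^ (t - k) := by
      rw [Finset.mul_sum]
      refine Finset.sum_congr rfl fun k hk => ?_
      rw [Nat.sub_add_comm (Finset.mem_Icc.1 hk).2, pow_succ]; ring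
    rw [Finset.sum_Icc_succ_top (by omega), h2, ih]
    simp only [Nat.sub_self, pow_succ]; ring

/-- The weights of the output policy: geometric, with the leftover mass on the first index. -/
noncomputable def outputWeight (T : ℕ) (α : ℝ) (t : ℕ) : ℝ :=
  if t = 1 then (1 - α) ^ (T - 1) else α * (1 - α) ^ (T - t)

lemma sum_Icc_one_eq {T : ℕ} (hT : 1 ≤ T) (f : ℕ → ℝ) :
    ∑ t ∈ Finset.Icc 1 T, f t = f 1 + ∑ t ∈ Finset.Icc 2 T, f t := by
  rw [← Finset.add_sum_Ioc_eq_sum_Icc hT]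
  rfl

lemma sum_outputWeight_mul {T : ℕ} (hT : 1 ≤ T) (α : ℝ) (x : ℕ → ℝ) :
    ∑ t ∈ Finset.Icc 1 T, outputWeight T α t * x t
      = (1 - α) ^ (T - 1) * x 1 + ∑ t ∈ Finset.Icc 2 T, α * (1 - α) ^ (T - t) * x t := by
  rw [sum_Icc_one_eq hT, outputWeight, if_pos rfl]
  congr 1
  refine Finset.sum_congr rfl fun t ht => ?_
  rw [outputWeight, if_neg (by have := (Finset.mem_Icc.1 ht).1; omega)]

lemma sum_outputWeight_mul' {T : ℕ} (hT : 1 ≤ T) (α : ℝ) (x : ℕ → ℝ) :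
    ∑ t ∈ Finset.Icc 1 T, outputWeight T α t * x t
      = (1 - α) ^ T * x 1 + ∑ t ∈ Finset.Icc 1 T, α * (1 - α) ^ (T - t) * x t := by
  rw [sum_outputWeight_mul hT, sum_Icc_one_eq hT]
  obtain ⟨k, rfl⟩ : ∃ k, T = k + 1 := ⟨T - 1, by omega⟩
  rw [Nat.add_sub_cancel, pow_succ]; ring

lemma sum_outputWeight {T : ℕ} (hT : 1 ≤ T) (α : ℝ) :
    ∑ t ∈ Finset.Icc 1 T, outputWeight T α t = 1 := by
  have h := sum_outputWeight_mul' hT α fun _ => 1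
  simp only [mul_one, sum_geometric_weights] at h
  rw [h]; ring

lemma outputWeight_nonneg {α : ℝ} (h0 : 0 ≤ α) (h1 : α ≤ 1) (T t : ℕ) :
    0 ≤ outputWeight T α t := by
  have := sub_nonneg.2 h1
  unfold outputWeight
  split_ifs <;> positivity

lemma le_maxUpTo {T : ℕ} (hT : 1 ≤ T) (f : ℕ → ℝ) {t : ℕ} (h1 : 1 ≤ t) (h2 : t ≤ T) :
    f t ≤ maxUpTo T hT f :=
  Finset.le_sup' f (Finset.mem_Icc.2 ⟨h1, h2⟩)

namespace CMDP

variable {S A : Type*} [Fintype S] [Fintype A] {m : ℕ}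

/-! ### The box of multipliers and the iterates -/

lemma convex_box (m : ℕ) (B : ℝ) : Convex ℝ (box m B) := by
  intro x hx y hy a b ha hb hab i
  have hx := hx i
  have hy := hy i
  simp only [PiLp.add_apply, PiLp.smul_apply, smul_eq_mul]
  refine ⟨add_nonneg (mul_nonneg ha hx.1) (mul_nonneg hb hy.1), ?_⟩
  calc _ ≤ a * (2 * B) + b * (2 * B) :=
        add_le_add (mul_le_mul_of_nonneg_left hx.2 ha) (mul_le_mul_of_nonneg_left hy.2 hb)
    _ = 2 * B := by rw [← add_mul, hab, one_mul]

lemma norm_le_of_abs_le {B : ℝ} (hB : 0 ≤ B) {v : EuclideanSpace ℝ (Fin m)}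
    (h : ∀ i, |v i| ≤ 2 * B) : ‖v‖ ≤ 2 * √(m : ℝ) * B := by
  have e : 2 * √(m : ℝ) * B = √(m * (2 * B) ^ 2) := by
    rw [Real.sqrt_mul (Nat.cast_nonneg m), Real.sqrt_sq (by positivity)]; ring
  rw [EuclideanSpace.norm_eq, e]
  refine Real.sqrt_le_sqrt ?_
  calc ∑ i, ‖v i‖ ^ 2 ≤ ∑ _i : Fin m, (2 * B) ^ 2 := Finset.sum_le_sum fun i _ =>
        pow_le_pow_left₀ (norm_nonneg _) (h i) 2
    _ = _ := by simp

lemma norm_sub_le_of_mem_box {B : ℝ} (hB : 0 ≤ B) {x y : EuclideanSpace ℝ (Fin m)}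
    (hx : x ∈ box m B) (hy : y ∈ box m B) : ‖x - y‖ ≤ 2 * √(m : ℝ) * B :=
  norm_le_of_abs_le hB fun i => by
    have hx := hx i
    have hy := hy i
    rw [PiLp.sub_apply]
    exact abs_le.2 ⟨by linarith, by linarith⟩

lemma zero_mem_box {B : ℝ} (hB : 0 ≤ B) : (0 : EuclideanSpace ℝ (Fin m)) ∈ box m B :=
  fun i => ⟨le_rfl, by simpa using hB⟩

section Run

variable {M : CMDP S A m} {T : ℕ} {α q η μ B : ℝ} {π : ℕ → Policy S A}
  {lamU lam lamB : ℕ → EuclideanSpace ℝ (Fin m)}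

lemma IsRun.lam_mem (h : M.IsRun T α q η μ B π lamU lam lamB) (hB : 0 ≤ B) {t : ℕ} (ht : t ≤ T) :
    lam t ∈ box m B := by
  cases t with
  | zero => rw [h.init]; exact zero_mem_box hB
  | succ t => exact h.step_mem t (by omega)

lemma IsRun.lamB_mem (h : M.IsRun T α q η μ B π lamU lam lamB) (hB : 0 ≤ B) (h0 : 0 ≤ α)
    (h1 : α ≤ 1) {t : ℕ} (ht : t ≤ T) : lamB t ∈ box m B := by
  induction t with
  | zero => rw [h.initB]; exact zero_mem_box hB
  | succ t ih =>
    rw [h.average t (by omega)]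
    exact convex_box m B (ih (by omega)) (h.lam_mem hB ht) (sub_nonneg.2 h1) h0 (by ring)

lemma IsRun.lamU_mem (h : M.IsRun T α q η μ B π lamU lam lamB) (hB : 0 ≤ B) (h0 : 0 ≤ α)
    (h1 : α ≤ 1) (hq0 : 0 ≤ q) (hq1 : q ≤ 1) {t : ℕ} (ht1 : 1 ≤ t) (ht : t ≤ T) :
    lamU t ∈ box m B := by
  obtain ⟨k, rfl⟩ : ∃ k, t = k + 1 := ⟨t - 1, by omega⟩
  rw [h.search k (by omega)]
  exact convex_box m B (h.lamB_mem hB h0 h1 (by omega)) (h.lam_mem hB (by omega))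
    (sub_nonneg.2 hq1) hq0 (by ring)

end Run

/-! ### The primal-dual certificate -/

/-- The occupancy measure of the output policy is the weighted average of those of the iterates. -/
lemma IsOutput.visit_eq {M : CMDP S A m} {T : ℕ} (hT : 1 ≤ T) {α : ℝ} (h0 : 0 ≤ α) (h1 : α ≤ 1)
    {π : ℕ → Policy S A} {πt : Policy S A} (h : M.IsOutput T α π πt) (s : S) (a : A) :
    M.visit πt s a = ∑ t ∈ Finset.Icc 1 T, outputWeight T α t * M.visit (π t) s a := by
  refine M.visit_of_mixture _ _ (fun t _ => outputWeight_nonneg h0 h1 T t)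
    (sum_outputWeight hT α) π πt (fun s hs a => ?_) s a
  rw [sum_outputWeight_mul hT] at hs ⊢
  rw [sum_outputWeight_mul hT]
  exact h s hs a

lemma IsOutput.lagr_eq {M : CMDP S A m} {T : ℕ} (hT : 1 ≤ T) {α : ℝ} (h0 : 0 ≤ α) (h1 : α ≤ 1)
    {π : ℕ → Policy S A} {πt : Policy S A} (h : M.IsOutput T α π πt)
    (l : EuclideanSpace ℝ (Fin m)) :
    M.lagr πt l = ∑ t ∈ Finset.Icc 1 T, outputWeight T α t * M.lagr (π t) l := by
  simp_rw [CMDP.lagr_eq, mul_sub, Finset.sum_sub_distrib]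
  rw [← Finset.sum_mul, sum_outputWeight hT, one_mul,
    M.discounted_of_mixture _ _ π πt (h.visit_eq hT h0 h1)]

/-- The model of the dual function at `x` built from the policy `π`, evaluated at `l`, is the
Lagrangian of `π` up to the value error, the entropy bonus and a quadratic term. -/
lemma dual_model_le (M : CMDP S A m) {τ μ : ℝ} (hτ : 0 < τ) {x : EuclideanSpace ℝ (Fin m)}
    {πs : Policy S A} (h : M.IsRegOptimal τ μ x πs) (π : Policy S A)
    (l : EuclideanSpace ℝ (Fin m)) :
    M.dual τ μ x + inner ℝ (M.gradEst μ π x) (l - x) + μ / 2 * ‖l - x‖ ^ 2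
      ≤ M.lagr π l + |M.valueErr πs π x| + τ * Real.log (Fintype.card A) / (1 - M.gam)
        + μ / 2 * ‖l‖ ^ 2 := by
  have h1 := M.regLagr_shift 0 μ π x l
  have h2 : M.dual τ μ x = M.regLagr 0 μ π x + M.valueErr πs π x + τ * M.entropy πs := by
    rw [dual_eq M hτ h, valueErr, regLagr, regLagr]; ring
  have h3 := mul_le_mul_of_nonneg_left (M.entropy_le πs) hτ.le
  rw [mul_div_assoc'] at h3
  have h4 := le_abs_self (M.valueErr πs π x)
  have h5 : M.regLagr 0 μ π l = M.lagr π l + μ / 2 * ‖l‖ ^ 2 := by rw [regLagr]; ring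
  linarith

/-- The primal-dual certificate: the dual value at the averaged multiplier is at most the
Lagrangian of the output policy at any multiplier `l` of the box, up to the solver errors, the
regularization bias, and the initial error, which is carried by the first policy. -/
lemma dual_average_le [DecidableEq S] (M : CMDP S A m) {τ μ : ℝ} (hτ : 0 < τ) (hμ : 0 < μ)
    {T : ℕ} (hT : 1 ≤ T) {B : ℝ} (hB : 0 ≤ B) {πs : EuclideanSpace ℝ (Fin m) → Policy S A}
    (hπs : ∀ x ∈ box m B, M.IsRegOptimal τ μ x (πs x)) {C β : ℝ} (hC : 1 / 2 ≤ C) (hβ0 : 0 < β)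
    (hβ1 : β < 1) (hErg : ∀ x ∈ box m B, M.UniformlyErgodic (πs x) C β) {Ld α q η : ℝ}
    (hLd : Ld = 2 * M.Rmax ^ 2 * ergConst C β / ((1 - M.gam) ^ 2 * τ) + μ)
    (hα0 : 0 < α) (hα1 : α < 1) (hLα : Ld * α ^ 2 = μ / 2) (hq : q = α / (1 + α))
    (hη : η = α / (μ * (1 - α))) {π : ℕ → Policy S A}
    {lamU lam lamB : ℕ → EuclideanSpace ℝ (Fin m)} (hRun : M.IsRun T α q η μ B π lamU lam lamB)
    {πt : Policy S A} (hOut : M.IsOutput T α π πt) {Δ δ : ℝ}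
    (hΔ : ∀ t, 1 ≤ t → t ≤ T → |M.valueErr (πs (lamU t)) (π t) (lamU t)| ≤ Δ)
    (hδ : ∀ t, 1 ≤ t → t ≤ T → ‖M.gradErr τ μ (π t) (lamU t)‖ ≤ δ)
    {l : EuclideanSpace ℝ (Fin m)} (hl : l ∈ box m B) :
    M.dual τ μ (lamB T) ≤ M.lagr πt l - (1 - α) ^ T * inner ℝ l (M.Vvec (π 1) - M.c)
      + (Δ + τ * Real.log (Fintype.card A) / (1 - M.gam) + μ / 2 * ‖l‖ ^ 2
        + 2 * √(m : ℝ) * B * δ) := by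
  have hq0 : 0 ≤ q := by rw [hq]; positivity
  have hq1 : q ≤ 1 := by rw [hq, div_le_one (by linarith)]; linarith
  have hU := fun t (h1 : 1 ≤ t) (h2 : t ≤ T) => hRun.lamU_mem hB hα0.le hα1.le hq0 hq1 h1 h2
  have hδ0 : 0 ≤ δ := (norm_nonneg _).trans (hδ 1 le_rfl hT)
  set Y := Δ + τ * Real.log (Fintype.card A) / (1 - M.gam) + μ / 2 * ‖l‖ ^ 2
    + 2 * √(m : ℝ) * B * δ with hY
  have hstep : ∀ t < T, M.dual τ μ (lamB (t + 1)) + μ / 2 * ‖l - lam (t + 1)‖ ^ 2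
      ≤ (1 - α) * (M.dual τ μ (lamB t) + μ / 2 * ‖l - lam t‖ ^ 2)
        + α * (M.lagr (π (t + 1)) l + Y) := by
    intro t ht
    have hx := hU (t + 1) (by omega) (by omega)
    have hopt := hπs _ hx
    have herg := hErg _ hx
    have hsearch : (1 + α) • lamU (t + 1) = lamB t + α • lam t := by
      rw [hRun.search t ht, smul_add, smul_smul, smul_smul, hq]
      have e1 : (1 + α) * (1 - α / (1 + α)) = 1 := by field_simp; ring
      have e2 : (1 + α) * (α / (1 + α)) = α := by field_simp
      rw [e1, e2, one_smul]
    have hup := M.dual_upper hτ hC hβ0 hβ1 hopt herg (lamB (t + 1))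
    rw [← hLd] at hup
    have hlow := M.dual_lower hτ hopt (lamB t)
    have hlow' : M.dual τ μ (lamU (t + 1))
        + inner ℝ (M.gradEst μ (πs (lamU (t + 1))) (lamU (t + 1))) (lamB t - lamU (t + 1))
        ≤ M.dual τ μ (lamB t) := by
      have : 0 ≤ μ / 2 * ‖lamB t - lamU (t + 1)‖ ^ 2 := by positivity
      linarith
    have key := accelerated_step (convex_box m B) hμ hα0 hα1 hLα hη hsearch (hRun.average t ht)
      (hRun.step_mem t ht) hl (hRun.step t ht) hup hlow'
    have hmodel := M.dual_model_le hτ hopt (π (t + 1)) l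
    have hΔt := hΔ (t + 1) (by omega) (by omega)
    have hδt := hδ (t + 1) (by omega) (by omega)
    rw [gradErr, M.gradient_dual hτ hμ hC hβ0 hβ1 hopt herg] at hδt
    have herr := mul_le_mul hδt (norm_sub_le_of_mem_box hB (hRun.step_mem t ht) hx)
      (norm_nonneg _) hδ0
    refine key.trans ?_
    have := mul_le_mul_of_nonneg_left (add_le_add hmodel herr) hα0.le
    have h2 : α * (M.lagr (π (t + 1)) l + |M.valueErr (πs (lamU (t + 1))) (π (t + 1))
        (lamU (t + 1))| + τ * Real.log (Fintype.card A) / (1 - M.gam) + μ / 2 * ‖l‖ ^ 2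
        + δ * (2 * √(m : ℝ) * B)) ≤ α * (M.lagr (π (t + 1)) l + Y) :=
      mul_le_mul_of_nonneg_left (by rw [hY]; linarith) hα0.le
    linarith
  -- The first search point is the origin, so the initial dual value is a value of `π 1`.
  have hinit : M.dual τ μ (lamB 0) + μ / 2 * ‖l - lam 0‖ ^ 2 ≤ M.V 0 (π 1) + Y := by
    have hU1 : lamU 1 = 0 := by
      rw [hRun.search 0 (by omega), hRun.init, hRun.initB, smul_zero, smul_zero, add_zero]
    have h0 := M.dual_model_le hτ (hπs _ (hU 1 le_rfl hT)) (π 1) 0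
    have hΔ1 := hΔ 1 le_rfl hT
    rw [hU1] at h0 hΔ1
    rw [hRun.init, hRun.initB, sub_zero]
    have hV : M.lagr (π 1) 0 = M.V 0 (π 1) := by rw [lagr, inner_zero_left, add_zero]
    simp only [hV, sub_zero, inner_zero_right, norm_zero] at h0
    have : 0 ≤ 2 * √(m : ℝ) * B * δ := by positivity
    rw [hY]
    linarith
  have hrec := le_of_geometric_recursion (p := fun t => M.dual τ μ (lamB t)
    + μ / 2 * ‖l - lam t‖ ^ 2) (X := fun t => M.lagr (π t) l + Y) hα1.le hstep T le_rfl
  have hpow : 0 ≤ (1 - α) ^ T := pow_nonneg (sub_nonneg.2 hα1.le) T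
  have h1 := mul_le_mul_of_nonneg_left hinit hpow
  have h2 := sum_outputWeight_mul' hT α fun t => M.lagr (π t) l
  rw [← hOut.lagr_eq hT hα0.le hα1.le] at h2
  simp_rw [mul_add, Finset.sum_add_distrib, ← Finset.sum_mul, sum_geometric_weights] at hrec
  have h3 : 0 ≤ μ / 2 * ‖l - lam T‖ ^ 2 := by positivity
  have h4 : M.lagr (π 1) l = M.V 0 (π 1) + inner ℝ l (M.Vvec (π 1) - M.c) := rfl
  rw [h4] at h2
  linarith

/-! ### Feasible policies -/

/-- Weak duality against feasible policies. -/
lemma V_le_dual (M : CMDP S A m) {τ μ : ℝ} (hτ : 0 < τ) (hμ : 0 < μ)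
    {x : EuclideanSpace ℝ (Fin m)} (hx : ∀ i, 0 ≤ x i) {π : Policy S A}
    (hπ : ∀ i, M.c i ≤ M.V i.succ π) : M.V 0 π ≤ M.dual τ μ x := by
  refine le_trans ?_ (M.regLagr_le_dual hτ μ x π)
  have h1 : 0 ≤ inner ℝ x (M.Vvec π - M.c) := by
    rw [inner_eq_sum]
    exact Finset.sum_nonneg fun i _ => mul_nonneg (hx i) (sub_nonneg.2 (hπ i))
  have h2 := mul_nonneg hτ.le (M.entropy_nonneg π)
  have h3 : 0 ≤ μ / 2 * ‖x‖ ^ 2 := by positivity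
  rw [regLagr, lagr]
  linarith

/-- Under the Slater condition, a policy can be made feasible by mixing it with the Slater policy,
at a cost proportional to its total constraint violation. -/
lemma exists_feasible (M : CMDP S A m) {ξ B : ℝ} (hSlater : M.Slater ξ)
    (hB : B = M.rmax 0 / ((1 - M.gam) * ξ)) (π : Policy S A) :
    ∃ π' : Policy S A, (∀ i, M.c i ≤ M.V i.succ π') ∧
      M.V 0 π - B * ∑ i : Fin m, max 0 (M.c i - M.V i.succ π) ≤ M.V 0 π' := by
  obtain ⟨hξ, πξ, hπξ⟩ := hSlater
  set v := ∑ i : Fin m, max 0 (M.c i - M.V i.succ π) with hv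
  have hv0 : 0 ≤ v := Finset.sum_nonneg fun i _ => le_max_left _ _
  have hvi : ∀ i, M.c i - M.V i.succ π ≤ v := fun i => (le_max_right 0 _).trans
    (Finset.single_le_sum (f := fun i : Fin m => max 0 (M.c i - M.V i.succ π))
      (fun i _ => le_max_left _ _) (Finset.mem_univ i))
  have hden : 0 < ξ + v := by linarith
  set θ := v / (ξ + v) with hθ
  have hθ0 : 0 ≤ θ := by positivity
  have hθ1 : θ ≤ 1 := by rw [hθ, div_le_one hden]; linarith
  have hθv : (1 - θ) * v = θ * ξ := by rw [hθ]; field_simp; ring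
  obtain ⟨π', hvis, -, -⟩ := M.exists_mixture π πξ hθ0 hθ1
  have hV : ∀ i, M.V i π' = (1 - θ) * M.V i π + θ * M.V i πξ := by
    intro i
    have := M.discounted_of_mixture (Finset.univ : Finset (Fin 2)) ![1 - θ, θ] ![π, πξ] π'
      (by simpa using hvis) (M.r i)
    simpa [V] using this
  refine ⟨π', fun i => ?_, ?_⟩
  · rw [hV]
    have h1 := mul_le_mul_of_nonneg_left (hvi i) (sub_nonneg.2 hθ1)
    have h2 := mul_le_mul_of_nonneg_left (hπξ i) hθ0
    linarith
  · rw [hV]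
    have h1 : θ * ξ ≤ v := by
      rw [← hθv]; exact mul_le_of_le_one_left hv0 (by linarith)
    have h2 : M.rmax 0 / (1 - M.gam) = B * ξ := by
      rw [hB]; have := M.one_sub_gam_pos.ne'; field_simp
    have hB0 : 0 ≤ B := by
      rw [hB]; exact div_nonneg (M.rmax_nonneg 0) (mul_pos M.one_sub_gam_pos hξ).le
    have h3 := mul_le_mul_of_nonneg_left ((M.V_le 0 π).trans_eq h2) hθ0
    have h4 := mul_nonneg hθ0 (M.V_nonneg 0 πξ)
    have h5 := mul_le_mul_of_nonneg_left h1 hB0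
    linarith

end CMDP

/-! ### The convergence bounds -/

/-- The linear effect `2 p δ` of gradient errors is dominated by the square-root term, since the
errors are at most `R`. -/
lemma two_mul_le_sqrt_mul {η p δ R : ℝ} (hη : 0 < η) (hp : 0 ≤ p) (hδ : 0 ≤ δ) (hR : δ ≤ R) :
    2 * p * δ ≤ √(8 * η * p * δ) * (2 * R + 2 * p / η) := by
  have hR0 : 0 ≤ R := hδ.trans hR
  refine (pow_le_pow_iff_left₀ (by positivity) (by positivity) two_ne_zero).1 ?_
  rw [mul_pow (√_), Real.sq_sqrt (by positivity)]
  have h1 : 8 * η * p * δ * (2 * R + 2 * p / η) ^ 2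
      = 32 * η * p * δ * R ^ 2 + 64 * p ^ 2 * δ * R + 32 * p ^ 3 * δ / η := by
    field_simp; ring
  rw [h1]
  have h2 : p ^ 2 * δ * δ ≤ p ^ 2 * δ * R := mul_le_mul_of_nonneg_left hR (by positivity)
  have h3 : 0 ≤ 32 * η * p * δ * R ^ 2 := by positivity
  have h4 : 0 ≤ 32 * p ^ 3 * δ / η := by positivity
  have h5 : 0 ≤ p ^ 2 * δ * δ := by positivity
  nlinarith

theorem theorem1 {S A : Type*} [Fintype S] [DecidableEq S] [Fintype A] {m : ℕ}
    (M : CMDP S A m)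
    -- regularization parameters and number of iterations
    (τ μ : ℝ) (hτ : 0 < τ) (hμ : 0 < μ) (T : ℕ) (hT : 1 ≤ T)
    -- Slater condition and the radius `B`
    (ξ B : ℝ) (hSlater : M.Slater ξ) (hB : B = M.rmax 0 / ((1 - M.gam) * ξ))
    -- the regularized optimal policies, and uniform ergodicity of their chains
    (πs : EuclideanSpace ℝ (Fin m) → Policy S A)
    (hπs : ∀ x ∈ CMDP.box m B, M.IsRegOptimal τ μ x (πs x))
    (C β : ℝ) (hC : 0 < C) (hβ0 : 0 < β) (hβ1 : β < 1)
    (hErg : ∀ x ∈ CMDP.box m B, M.UniformlyErgodic (πs x) C β)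
    -- automatic when there are at least two states (take `t = 0` in the ergodicity bound)
    (hC1 : Fintype.card S = 1 → 1 / 2 ≤ C)
    -- smoothness parameter and stepsizes
    (Ld α q η : ℝ)
    (hLd : Ld = 2 * M.Rmax ^ 2 * ergConst C β / ((1 - M.gam) ^ 2 * τ) + μ)
    (hα : α = √(μ / (2 * Ld)))
    (hq : q = (2 * α - μ / Ld) / (2 - μ / Ld))
    (hη : η = α / (μ * (1 - α)))
    -- the run of the algorithm and its output
    (π : ℕ → Policy S A) (lamU lam lamB : ℕ → EuclideanSpace ℝ (Fin m))
    (hRun : M.IsRun T α q η μ B π lamU lam lamB)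
    (πt : Policy S A) (hOut : M.IsOutput T α π πt)
    -- the minimizer of the regularized dual function
    (lamStar : EuclideanSpace ℝ (Fin m)) (hStar : lamStar ∈ CMDP.orthant m)
    (hStarMin : IsMinOn (M.dual τ μ) (CMDP.orthant m) lamStar)
    -- the largest inner-solver errors, and `ζ_T`
    (Δmax δmax ζ : ℝ)
    (hΔmax : Δmax = maxUpTo T hT fun t => |M.valueErr (πs (lamU t)) (π t) (lamU t)|)
    (hδmax : δmax = maxUpTo T hT fun t => ‖M.gradErr τ μ (π t) (lamU t)‖)
    (hζ : ζ = 2 * (1 - √(μ / (2 * Ld))) ^ ((T : ℝ) / 2)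
          * √(η * M.K0 τ μ α η (lamB 0) (lam 0) lamStar)
        + √(8 * η * √(m : ℝ) * B * δmax)) :
    -- optimality gap
    (M.optValue - M.V 0 πt ≤
      ζ * (2 * M.Rmax / (1 - M.gam) + 2 * √(m : ℝ) * B / η)
        + √(2 * Ld / μ) * Δmax
        + τ * Real.log (Fintype.card A) / (1 - M.gam)
        + 6 * μ * m * B ^ 2) ∧
    -- constraint violation, in the `ℓ¹` norm
    (∑ i : Fin m, |max 0 ((M.c - M.Vvec πt) i)| ≤
      ζ * (2 * M.Rmax / ((1 - M.gam) * B) + 2 * √(m : ℝ) / η)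
        + √(2 * Ld / μ) * (Δmax / B)
        + τ * Real.log (Fintype.card A) / ((1 - M.gam) * B)
        + 6 * μ * m * B
        + 2 * (1 - √(μ / (2 * Ld))) ^ (T - 1) * (√(m : ℝ) * M.Rmax / (1 - M.gam))) := by
  have hg := M.one_sub_gam_pos
  have hξ : 0 < ξ := hSlater.1
  obtain ⟨πξ, hπξ⟩ := hSlater.2
  have hB0 : 0 < B := by
    rw [hB]; exact div_pos (M.rmax_pos πξ 0) (mul_pos hg hξ)
  have hC2 : 1 / 2 ≤ C := M.half_le_of_uniformlyErgodic (hErg 0 (CMDP.zero_mem_box hB0.le)) hC1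
  have hLμ : μ ≤ Ld := by
    have h1 := M.one_add_mixSum_le_ergConst hC2 hβ0 hβ1
    have h2 := M.mixSum_nonneg hC hβ0
    have h3 : 0 ≤ ergConst C β := by linarith
    rw [hLd]
    have : 0 ≤ 2 * M.Rmax ^ 2 * ergConst C β / ((1 - M.gam) ^ 2 * τ) := by positivity
    linarith
  have hLd0 : 0 < Ld := hμ.trans_le hLμ
  have hα0 : 0 < α := by rw [hα]; exact Real.sqrt_pos.2 (by positivity)
  have hαsq : α ^ 2 = μ / (2 * Ld) := by rw [hα, Real.sq_sqrt (by positivity)]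
  have hα1 : α < 1 := by
    have : α ^ 2 < 1 := by rw [hαsq, div_lt_one (by positivity)]; linarith
    nlinarith
  have hLα : Ld * α ^ 2 = μ / 2 := by rw [hαsq]; field_simp
  have hq' : q = α / (1 + α) := by
    have e : μ / Ld = 2 * α ^ 2 := by rw [hαsq]; field_simp
    rw [hq, e, div_eq_div_iff (by nlinarith) (by linarith)]
    ring
  have hη0 : 0 < η := by rw [hη]; exact div_pos hα0 (mul_pos hμ (sub_pos.2 hα1))
  have hq0 : 0 ≤ q := by rw [hq']; positivity
  have hq1 : q ≤ 1 := by rw [hq', div_le_one (by linarith)]; linarith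
  have hsqrt : 1 ≤ √(2 * Ld / μ) := by
    rw [Real.one_le_sqrt, one_le_div hμ]; linarith
  rw [← hα] at hζ ⊢
  have hΔ : ∀ t, 1 ≤ t → t ≤ T → |M.valueErr (πs (lamU t)) (π t) (lamU t)| ≤ Δmax := by
    intro t h1 h2
    rw [hΔmax]
    exact le_maxUpTo hT (fun t => |M.valueErr (πs (lamU t)) (π t) (lamU t)|) h1 h2
  have hδ : ∀ t, 1 ≤ t → t ≤ T → ‖M.gradErr τ μ (π t) (lamU t)‖ ≤ δmax := by
    intro t h1 h2
    rw [hδmax]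
    exact le_maxUpTo hT (fun t => ‖M.gradErr τ μ (π t) (lamU t)‖) h1 h2
  have hΔ0 : 0 ≤ Δmax := (abs_nonneg _).trans (hΔ 1 le_rfl hT)
  have hδ0 : 0 ≤ δmax := (norm_nonneg _).trans (hδ 1 le_rfl hT)
  have hδR : δmax ≤ M.Rmax / (1 - M.gam) := by
    rw [hδmax, maxUpTo]
    refine Finset.sup'_le _ _ fun t ht => ?_
    have hx := hRun.lamU_mem hB0.le hα0.le hα1.le hq0 hq1 (Finset.mem_Icc.1 ht).1
      (Finset.mem_Icc.1 ht).2
    rw [CMDP.gradErr, M.gradient_dual hτ hμ hC2 hβ0 hβ1 (hπs _ hx) (hErg _ hx), CMDP.gradEst,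
      CMDP.gradEst, add_sub_add_right_eq_sub, sub_sub_sub_cancel_right]
    exact M.norm_Vvec_sub_le _ _
  have hΔL : Δmax ≤ √(2 * Ld / μ) * Δmax := le_mul_of_one_le_left hΔ0 hsqrt
  -- The first summand of `ζ` is nonnegative and is dropped.
  have hδζ : 2 * √(m : ℝ) * B * δmax
      ≤ ζ * (2 * M.Rmax / (1 - M.gam) + 2 * √(m : ℝ) * B / η) := by
    have h1 := two_mul_le_sqrt_mul (p := √(m : ℝ) * B) hη0 (by positivity) hδ0 hδR
    have h2 : √(8 * η * (√(m : ℝ) * B) * δmax) ≤ ζ := by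
      rw [hζ, ← mul_assoc (8 * η)]
      refine le_add_of_nonneg_left (mul_nonneg (mul_nonneg zero_le_two
        (Real.rpow_nonneg (sub_nonneg.2 hα1.le) _)) (Real.sqrt_nonneg _))
    have h3 : 0 ≤ 2 * (M.Rmax / (1 - M.gam)) + 2 * (√(m : ℝ) * B) / η := by
      have := M.Rmax_nonneg
      positivity
    have h4 := h1.trans (mul_le_mul_of_nonneg_right h2 h3)
    have e : 2 * (M.Rmax / (1 - M.gam)) + 2 * (√(m : ℝ) * B) / η
        = 2 * M.Rmax / (1 - M.gam) + 2 * √(m : ℝ) * B / η := by ring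
    rw [e] at h4
    linarith
  have hlamB : ∀ i, 0 ≤ lamB T i := fun i => (hRun.lamB_mem hB0.le hα0.le hα1.le le_rfl i).1
  have hcert := fun (l : EuclideanSpace ℝ (Fin m)) (hl : l ∈ CMDP.box m B) =>
    M.dual_average_le hτ hμ hT hB0.le hπs hC2 hβ0 hβ1 hErg hLd hα0 hα1 hLα hq' hη hRun hOut
      hΔ hδ hl
  constructor
  · have h0 := hcert 0 (CMDP.zero_mem_box hB0.le)
    simp only [CMDP.lagr, inner_zero_left, norm_zero] at h0
    have hopt : M.optValue ≤ M.V 0 πt + (Δmax + τ * Real.log (Fintype.card A) / (1 - M.gam)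
        + 2 * √(m : ℝ) * B * δmax) := by
      refine csSup_le ⟨_, πξ, fun i => by linarith [hπξ i], rfl⟩ ?_
      rintro _ ⟨π', hπ', rfl⟩
      have := M.V_le_dual hτ hμ hlamB hπ'
      linarith
    have hmB : 0 ≤ 6 * μ * m * B ^ 2 := by positivity
    linarith
  · set v := ∑ i : Fin m, max 0 (M.c i - M.V i.succ πt) with hv
    have hgoal : ∑ i : Fin m, |max 0 ((M.c - M.Vvec πt) i)| = v :=
      Finset.sum_congr rfl fun i _ => abs_of_nonneg (le_max_left _ _)
    -- the extreme multiplier supported on the violated constraints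
    set l : EuclideanSpace ℝ (Fin m) :=
      WithLp.toLp 2 fun i => if 0 ≤ M.c i - M.V i.succ πt then 2 * B else 0 with hl
    have hli : ∀ i, l i = if 0 ≤ M.c i - M.V i.succ πt then 2 * B else 0 := fun i => rfl
    have hlbox : l ∈ CMDP.box m B := by
      intro i
      rw [hli]
      split_ifs
      · exact ⟨by positivity, le_rfl⟩
      · exact ⟨le_rfl, by positivity⟩
    have hlnorm : ‖l‖ ≤ 2 * √(m : ℝ) * B := CMDP.norm_le_of_abs_le hB0.le fun i => by
      rw [abs_of_nonneg (hlbox i).1]; exact (hlbox i).2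
    have hlsq : ‖l‖ ^ 2 ≤ 4 * m * B ^ 2 := by
      refine (pow_le_pow_left₀ (norm_nonneg _) hlnorm 2).trans_eq ?_
      rw [mul_pow, mul_pow, Real.sq_sqrt (Nat.cast_nonneg m)]; ring
    have hlv : inner ℝ l (M.Vvec πt - M.c) = -(2 * B * v) := by
      rw [CMDP.inner_eq_sum, hv, Finset.mul_sum, ← Finset.sum_neg_distrib]
      refine Finset.sum_congr rfl fun i _ => ?_
      rw [hli, show (M.Vvec πt - M.c) i = M.V i.succ πt - M.c i from rfl]
      split_ifs with h
      · rw [max_eq_right h]; ring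
      · rw [max_eq_left (not_le.1 h).le]; ring
    have hl1 : -inner ℝ l (M.Vvec (π 1) - M.c)
        ≤ 2 * √(m : ℝ) * B * (M.Rmax / (1 - M.gam)) := by
      have h1 : 0 ≤ inner ℝ l (M.Vvec πξ - M.c) := by
        rw [CMDP.inner_eq_sum]
        refine Finset.sum_nonneg fun i _ => mul_nonneg (hlbox i).1 ?_
        have : (M.Vvec πξ - M.c) i = M.V i.succ πξ - M.c i := rfl
        rw [this]
        linarith [hπξ i]
      have h2 : M.Vvec πξ - M.c = (M.Vvec πξ - M.Vvec (π 1)) + (M.Vvec (π 1) - M.c) := by abel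
      rw [h2, inner_add_right] at h1
      have h3 := (real_inner_le_norm l (M.Vvec πξ - M.Vvec (π 1))).trans
        (mul_le_mul hlnorm (M.norm_Vvec_sub_le _ _) (norm_nonneg _) (by positivity))
      linarith
    have hpow : (1 - α) ^ T ≤ (1 - α) ^ (T - 1) :=
      pow_le_pow_of_le_one (sub_nonneg.2 hα1.le) (by linarith) (Nat.sub_le T 1)
    have hinit : (1 - α) ^ T * -inner ℝ l (M.Vvec (π 1) - M.c)
        ≤ (1 - α) ^ (T - 1) * (2 * √(m : ℝ) * B * (M.Rmax / (1 - M.gam))) := by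
      have hR := M.Rmax_nonneg
      exact (mul_le_mul_of_nonneg_left hl1 (pow_nonneg (sub_nonneg.2 hα1.le) T)).trans
        (mul_le_mul_of_nonneg_right hpow (by positivity))
    have h0 := hcert l hlbox
    rw [CMDP.lagr, hlv] at h0
    obtain ⟨π', hfeas, hπ'⟩ := M.exists_feasible hSlater hB πt
    rw [← hv] at hπ'
    have h1 := M.V_le_dual hτ hμ hlamB hfeas
    have h2 : μ / 2 * ‖l‖ ^ 2 ≤ 2 * μ * m * B ^ 2 := by
      have := mul_le_mul_of_nonneg_left hlsq (half_pos hμ).le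
      linarith
    have hmB : 0 ≤ μ * m * B ^ 2 := by positivity
    have hBv : v * B ≤ ζ * (2 * M.Rmax / (1 - M.gam) + 2 * √(m : ℝ) * B / η)
        + √(2 * Ld / μ) * Δmax + τ * Real.log (Fintype.card A) / (1 - M.gam)
        + 6 * μ * m * B ^ 2
        + (1 - α) ^ (T - 1) * (2 * √(m : ℝ) * B * (M.Rmax / (1 - M.gam))) := by
      linarith
    rw [hgoal]
    refine ((le_div_iff₀ hB0).2 hBv).trans_eq ?_
    have := hg.ne'
    field_simp
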